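/- Fix $n \ge 2$. For $m \ge 2$ let $a_1, \dots, a_m$ be independent random points, each uniformly distributed on the unit sphere $S^{n-1} \subset \mathbb{R}^n$, and let $P = \operatorname{conv}(a_1, \dots, a_m)$; the law of $P$ is denoted $P(n,m)$. Let $u, v \in \mathbb{R}^n$ be nonparallel (that is, linearly independent), and let $P' = P \cap \operatorname{Span}(u,v)$. Then the expected number of edges (one-dimensional faces) of $P'$ is $\tilde{O}(m^{1/(n-1)})$. That is, there are constants $C$ and $k$, depending only on $n$, such that for all such $u$, $v$ and all $m \ge 2$, $$\mathbb{E}\bigl[\#\{\text{edges of } P'\}\bigr] \le C\, m^{1/(n-1)} (\log m)^k .$$ -/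

import Mathlib

open MeasureTheory Set

noncomputable section

/-- The uniform probability measure on the unit sphere of `ℝⁿ`: normalised surface measure. -/
def sphereUniform (n : ℕ) : Measure (Metric.sphere (0 : EuclideanSpace ℝ (Fin n)) 1) :=
  ((volume : Measure (EuclideanSpace ℝ (Fin n))).toSphere univ)⁻¹ •
    (volume : Measure (EuclideanSpace ℝ (Fin n))).toSphere

/-- The law of `m` independent uniform points of the unit sphere of `ℝⁿ`. -/
def spherePoints (n m : ℕ) :
    Measure (Fin m → Metric.sphere (0 : EuclideanSpace ℝ (Fin n)) 1) :=
  Measure.pi fun _ => sphereUniform n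

/-- The convex hull of `m` points of the unit sphere of `ℝⁿ`. When `a` is distributed according to
`spherePoints n m`, this is the random polytope `P ∼ P(n, m)`. -/
def spherePolytope {n m : ℕ} (a : Fin m → Metric.sphere (0 : EuclideanSpace ℝ (Fin n)) 1) :
    Set (EuclideanSpace ℝ (Fin n)) :=
  convexHull ℝ (range fun i => (a i : EuclideanSpace ℝ (Fin n)))

/-- The edges of a polytope `Q`: its one-dimensional faces. A face is a nonempty set of all
maximisers over `Q` of a linear functional. -/
def polytopeEdges {n : ℕ} (Q : Set (EuclideanSpace ℝ (Fin n))) :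
    Set (Set (EuclideanSpace ℝ (Fin n))) :=
  {F | F.Nonempty ∧ IsExposed ℝ Q F ∧ Module.finrank ℝ (vectorSpan ℝ F) = 1}

/-- The number of edges of the section of `conv (a₁, …, aₘ)` by the linear span of `u` and `v`. -/
def sectionEdgeCount {n m : ℕ} (u v : EuclideanSpace ℝ (Fin n))
    (a : Fin m → Metric.sphere (0 : EuclideanSpace ℝ (Fin n)) 1) : ENNReal :=
  ((polytopeEdges (spherePolytope a ∩
    (Submodule.span ℝ {u, v} : Set (EuclideanSpace ℝ (Fin n))))).encard : ENNReal)

end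

/-! Every edge `F` of the section contains the midpoint of two of its points, and by Carathéodory
that midpoint is a strictly positive combination of vertices indexed by some `S` with at most `n +
1` elements. Such an `S` determines `F`, so the edges are at most as many as these supports
(`encard_polytopeEdges_le`). No general position is used: degenerate configurations only add
supports.

A point in the relative interior of an edge cannot be interior to `P`, so some hyperplane supports
`P` there, and all vertices of `S` lie on it. On the sphere this says that these vertices are the
ones nearest to the unit normal `w` (`exists_normal`). If the vertices are `2r`-dense, they are
within `2r` of `w`. Their convex combination then lies near the unit circle of the plane, so all of
`S` falls in a cap of radius `7r` about one of at most `10 / r` fixed points of that circle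
(`exists_ball_of_mem_edgeSupports`).

A given cap has measure `p` of order at most `r ^ (n - 1)`, so by independence the expected number
of pairs (support, cap) is at most `10 / r` times the sum of `p ^ |S|`, which is controlled by
powers of `m * p`. Taking `r ^ (n - 1)` to be a large multiple of `log m / m` makes `m * p`
logarithmic and `1 / r` at most `m ^ (1 / (n - 1))`. The vertices then fail to be dense with
probability so small that the trivial bound of order `m ^ (n + 1)` suffices on that event
(`exists_bad_set`, `sectionEdgeCount_le`).

The count is also shown to be measurable, because it depends only on which index sets are supports,
and each of these events is a difference of two countable unions of closed sets. -/

noncomputable section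

/-! ### Supporting functionals -/

/-- In finite dimension, a convex set has a supporting functional at every point outside its
interior. -/
lemma Convex.exists_support_of_notMem_interior {E : Type*} [NormedAddCommGroup E]
    [NormedSpace ℝ E] [FiniteDimensional ℝ E] {K : Set E} (hK : Convex ℝ K) {x : E} (hxK : x ∈ K)
    (hx : x ∉ interior K) : ∃ f : E →L[ℝ] ℝ, f ≠ 0 ∧ ∀ y ∈ K, f y ≤ f x := by
  by_cases hne : (interior K).Nonempty
  · obtain ⟨f, hf⟩ := geometric_hahn_banach_open_point hK.interior isOpen_interior hx
    refine ⟨f, ?_, ?_⟩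
    · rintro rfl
      obtain ⟨y, hy⟩ := hne
      simpa using hf y hy
    · intro y hy
      have h1 : K ⊆ closure (interior K) := by
        rw [hK.closure_interior_eq_closure_of_nonempty_interior hne]
        exact subset_closure
      have h2 : closure (interior K) ⊆ {z | f z ≤ f x} :=
        closure_minimal (fun z hz => (hf z hz).le) (isClosed_le f.continuous continuous_const)
      exact h2 (h1 hy)
  · rw [hK.interior_nonempty_iff_affineSpan_eq_top] at hne
    have hv : vectorSpan ℝ K < ⊤ := by
      rw [lt_top_iff_ne_top]
      intro h
      apply hne
      rw [AffineSubspace.affineSpan_eq_top_iff_vectorSpan_eq_top_of_nonempty]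
      · exact h
      · exact ⟨x, hxK⟩
    obtain ⟨f, hf0, hf⟩ := Submodule.exists_le_ker_of_lt_top _ hv
    refine ⟨LinearMap.toContinuousLinearMap f, ?_, ?_⟩
    · intro h
      exact hf0 (LinearMap.toContinuousLinearMap.map_eq_zero_iff.1 h)
    · intro y hy
      have := hf (vsub_mem_vectorSpan ℝ hy hxK)
      simp only [vsub_eq_sub, LinearMap.mem_ker, map_sub] at this
      simp only [LinearMap.coe_toContinuousLinearMap']
      linarith

variable {n m : ℕ}

/-! ### Positive convex combinations of the vertices -/

/-- Convex weights on `Fin m` whose support is exactly `S`. -/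
structure PosWeights (S : Finset (Fin m)) (c : Fin m → ℝ) : Prop where
  pos : ∀ i ∈ S, 0 < c i
  zero : ∀ i ∉ S, c i = 0
  sum : ∑ i, c i = 1

lemma PosWeights.nonneg {S : Finset (Fin m)} {c : Fin m → ℝ} (h : PosWeights S c) (i : Fin m) :
    0 ≤ c i := by
  by_cases hi : i ∈ S
  · exact (h.pos i hi).le
  · exact (h.zero i hi).ge

lemma PosWeights.mem_stdSimplex {S : Finset (Fin m)} {c : Fin m → ℝ} (h : PosWeights S c) :
    c ∈ stdSimplex ℝ (Fin m) := ⟨h.nonneg, h.sum⟩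

lemma PosWeights.nonempty {S : Finset (Fin m)} {c : Fin m → ℝ} (h : PosWeights S c) :
    S.Nonempty := by
  by_contra hS
  rw [Finset.not_nonempty_iff_eq_empty] at hS
  subst hS
  have := h.sum
  simp [h.zero] at this

/-- The combination of the points `a i` with coefficients `c i`. -/
def comb (a : Fin m → Metric.sphere (0 : EuclideanSpace ℝ (Fin n)) 1) (c : Fin m → ℝ) :
    EuclideanSpace ℝ (Fin n) :=
  ∑ i, c i • (a i : EuclideanSpace ℝ (Fin n))

variable {a : Fin m → Metric.sphere (0 : EuclideanSpace ℝ (Fin n)) 1}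

lemma comb_mem_spherePolytope {c : Fin m → ℝ} (hc : c ∈ stdSimplex ℝ (Fin m)) :
    comb a c ∈ spherePolytope a :=
  mem_convexHull_of_exists_fintype c (fun i => (a i : EuclideanSpace ℝ (Fin n))) hc.1 hc.2
    (fun i => mem_range_self i) rfl

lemma mem_spherePolytope_iff {x : EuclideanSpace ℝ (Fin n)} :
    x ∈ spherePolytope a ↔ ∃ c ∈ stdSimplex ℝ (Fin m), comb a c = x := by
  classical
  constructor
  · intro hx
    have h1 : range (fun i => (a i : EuclideanSpace ℝ (Fin n))) =
        (Fintype.linearCombination ℝ (fun i => (a i : EuclideanSpace ℝ (Fin n)))) ''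
          range (fun i : Fin m => Pi.single i (1 : ℝ)) := by
      rw [← range_comp]
      congr 1
      ext1 i
      simp [Fintype.linearCombination_apply, Pi.single_apply]
    rw [spherePolytope, h1, ← LinearMap.image_convexHull,
      convexHull_rangle_single_eq_stdSimplex] at hx
    obtain ⟨c, hc, rfl⟩ := hx
    exact ⟨c, hc, by simp [comb, Fintype.linearCombination_apply]⟩
  · rintro ⟨c, hc, rfl⟩
    exact comb_mem_spherePolytope hc

/-- Every point of the polytope is a strictly positive combination of at most `n + 1` vertices. -/
lemma exists_posWeights_card_le {x : EuclideanSpace ℝ (Fin n)} (hx : x ∈ spherePolytope a) :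
    ∃ (S : Finset (Fin m)) (c : Fin m → ℝ), S.card ≤ n + 1 ∧ PosWeights S c ∧ comb a c = x := by
  classical
  obtain ⟨ι, _, z, w, hz, hind, hw, hsum, hx⟩ := eq_pos_convex_span_of_mem_convexHull hx
  choose e he using fun i => hz (mem_range_self i)
  have hcard : Fintype.card ι ≤ n + 1 := by
    refine hind.card_le_finrank_succ.trans ?_
    have := Submodule.finrank_le (vectorSpan ℝ (range z))
    rw [finrank_euclideanSpace_fin] at this
    omega
  refine ⟨Finset.univ.image e, fun k => ∑ j, if e j = k then w j else 0,
    Finset.card_image_le.trans hcard, ⟨?_, ?_, ?_⟩, ?_⟩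
  · intro i hi
    obtain ⟨j, -, rfl⟩ := Finset.mem_image.1 hi
    refine Finset.sum_pos' (fun k _ => ?_) ⟨j, Finset.mem_univ _, by simpa using hw j⟩
    split_ifs
    exacts [(hw k).le, le_rfl]
  · intro i hi
    refine Finset.sum_eq_zero fun j _ => if_neg ?_
    rintro rfl
    exact hi (Finset.mem_image_of_mem _ (Finset.mem_univ j))
  · rw [Finset.sum_comm]
    simpa using hsum
  · rw [comb, ← hx]
    simp_rw [Finset.sum_smul]
    rw [Finset.sum_comm]
    refine Finset.sum_congr rfl fun j _ => ?_
    simp only [ite_smul, zero_smul, Finset.sum_ite_eq, Finset.mem_univ, if_true]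
    rw [← he j]

lemma comb_add_smul (c d : Fin m → ℝ) (s t : ℝ) :
    comb a (fun i => s * c i + t * d i) = s • comb a c + t • comb a d := by
  simp only [comb, Finset.smul_sum, add_smul, mul_smul, Finset.sum_add_distrib]

/-- If `c` is positive wherever `d` is, then `comb a c` is strictly between `comb a d` and another
point of the polytope. -/
lemma exists_comb_eq {S T : Finset (Fin m)} {c d : Fin m → ℝ} (hc : PosWeights S c)
    (hd : PosWeights T d) (hTS : T ⊆ S) :
    ∃ t : ℝ, 0 < t ∧ t < 1 ∧ ∃ y ∈ spherePolytope a,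
      comb a c = t • comb a d + (1 - t) • y := by
  obtain ⟨i₀, hi₀, hmin⟩ := S.exists_min_image c hc.nonempty
  have hm := hc.pos i₀ hi₀
  have hle : ∀ i, d i ≤ 1 := fun i => by
    rw [← hd.sum]; exact Finset.single_le_sum (fun j _ => hd.nonneg j) (Finset.mem_univ i)
  have hm1 : c i₀ ≤ 1 := by
    rw [← hc.sum]; exact Finset.single_le_sum (fun j _ => hc.nonneg j) (Finset.mem_univ i₀)
  -- With half the least positive weight of `c`, subtracting `t • d` leaves all weights nonnegative,
  -- and `t < 1` holds even when that weight is `1`.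
  set t := c i₀ / 2 with ht
  have ht1 : 0 < 1 - t := by linarith
  refine ⟨t, by positivity, by linarith, comb a (fun i => (1 - t)⁻¹ * c i + (-((1 - t)⁻¹ * t)) * d i),
    comb_mem_spherePolytope ⟨?_, ?_⟩, ?_⟩
  · intro i
    have : t * d i ≤ c i := by
      by_cases hi : i ∈ S
      · have := hmin i hi
        nlinarith [hle i, hd.nonneg i]
      · rw [hc.zero i hi, hd.zero i (fun h => hi (hTS h)), mul_zero]
    have h2 : (1 - t)⁻¹ * c i + (-((1 - t)⁻¹ * t)) * d i = (1 - t)⁻¹ * (c i - t * d i) := by ring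
    refine h2.ge.trans' ?_
    exact mul_nonneg (inv_nonneg.2 ht1.le) (by linarith)
  · rw [Finset.sum_add_distrib, ← Finset.mul_sum, ← Finset.mul_sum, hc.sum, hd.sum]
    field_simp
    ring
  · rw [comb_add_smul, smul_add, smul_smul, smul_smul]
    rw [mul_inv_cancel₀ ht1.ne', mul_neg, ← mul_assoc, mul_inv_cancel₀ ht1.ne']
    simp

/-! ### Edges of the section and the index sets that support them -/

/-- The section of the polytope by the span of `u` and `v`. -/
def sphereSection (u v : EuclideanSpace ℝ (Fin n))
    (a : Fin m → Metric.sphere (0 : EuclideanSpace ℝ (Fin n)) 1) :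
    Set (EuclideanSpace ℝ (Fin n)) :=
  spherePolytope a ∩ (Submodule.span ℝ {u, v} : Set (EuclideanSpace ℝ (Fin n)))

variable {Q F G : Set (EuclideanSpace ℝ (Fin n))} {p q : EuclideanSpace ℝ (Fin n)}

lemma isExtreme_of_mem_polytopeEdges (hF : F ∈ polytopeEdges Q) : IsExtreme ℝ Q F :=
  hF.2.1.isExtreme

lemma midpoint_mem_openSegment' (p q : EuclideanSpace ℝ (Fin n)) :
    midpoint ℝ p q ∈ openSegment ℝ p q :=
  ⟨1 / 2, 1 / 2, by norm_num, by norm_num, by norm_num, by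
    rw [midpoint_eq_smul_add, smul_add]; norm_num⟩

lemma exists_pair_of_mem_polytopeEdges (hF : F ∈ polytopeEdges Q) :
    ∃ p ∈ F, ∃ q ∈ F, p ≠ q := by
  by_contra! h
  have hs : F.Subsingleton := fun p hp q hq => h p hp q hq
  have := hF.2.2
  rw [vectorSpan_of_subsingleton ℝ hs] at this
  simp at this

/-- Since `F` is one-dimensional, it lies on the line through `p` and `q`. The functional exposing
`G` is equal at `p` and `q`, hence constant on that line. -/
lemma subset_of_mem_polytopeEdges (hF : F ∈ polytopeEdges Q) (hG : G ∈ polytopeEdges Q)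
    (hpq : p ≠ q) (hp : p ∈ F) (hq : q ∈ F) (hp' : p ∈ G) (hq' : q ∈ G) : F ⊆ G := by
  intro z hz
  have hpos : (⟨q -ᵥ p, vsub_mem_vectorSpan ℝ hq hp⟩ : vectorSpan ℝ F) ≠ 0 := by
    intro h
    rw [Subtype.ext_iff] at h
    exact hpq (sub_eq_zero.1 h).symm
  obtain ⟨c, hc⟩ := (finrank_eq_one_iff_of_nonzero' _ hpos).1 hF.2.2
    ⟨z -ᵥ p, vsub_mem_vectorSpan ℝ hz hp⟩
  have hc' : c • (q - p) = z - p := congrArg Subtype.val hc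
  obtain ⟨l, hl⟩ := hG.2.1 hG.1
  have hpl := hl ▸ hp'
  have hql := hl ▸ hq'
  have hpq : l p = l q := le_antisymm (hql.2 p hpl.1) (hpl.2 q hql.1)
  have hz' : l z = l p := by
    have := congrArg l hc'
    simp only [map_smul, map_sub, hpq, sub_self, smul_zero] at this
    linarith
  rw [hl]
  exact ⟨(isExtreme_of_mem_polytopeEdges hF).subset hz, fun y hy => by rw [hz']; exact hpl.2 y hy⟩

/-- Two edges are equal as soon as one contains the midpoint of two distinct points of the other. -/
lemma eq_of_midpoint_mem (hF : F ∈ polytopeEdges Q) (hG : G ∈ polytopeEdges Q)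
    (hpq : p ≠ q) (hp : p ∈ F) (hq : q ∈ F) (hmid : midpoint ℝ p q ∈ G) : F = G := by
  have hFe := isExtreme_of_mem_polytopeEdges hF
  have hGe := isExtreme_of_mem_polytopeEdges hG
  have hp' : p ∈ G := hGe.left_mem_of_mem_openSegment (hFe.subset hp) (hFe.subset hq) hmid
    (midpoint_mem_openSegment' p q)
  have hq' : q ∈ G := hGe.left_mem_of_mem_openSegment (hFe.subset hq) (hFe.subset hp) hmid
    (by rw [openSegment_symm]; exact midpoint_mem_openSegment' p q)
  exact (subset_of_mem_polytopeEdges hF hG hpq hp hq hp' hq').antisymm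
    (subset_of_mem_polytopeEdges hG hF hpq hp' hq' hp hq)

variable {u v : EuclideanSpace ℝ (Fin n)}

/-- `S` supports the edge `F` if the midpoint of two distinct points of `F` is a strictly positive
combination of the points with index in `S`. -/
def Supports (a : Fin m → Metric.sphere (0 : EuclideanSpace ℝ (Fin n)) 1)
    (S : Finset (Fin m)) (F : Set (EuclideanSpace ℝ (Fin n))) : Prop :=
  ∃ p ∈ F, ∃ q ∈ F, p ≠ q ∧ ∃ c, PosWeights S c ∧ midpoint ℝ p q = comb a c

/-- The sets of indices that support some edge of the section. -/
def edgeSupports (u v : EuclideanSpace ℝ (Fin n))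
    (a : Fin m → Metric.sphere (0 : EuclideanSpace ℝ (Fin n)) 1) : Set (Finset (Fin m)) :=
  {S | ∃ F ∈ polytopeEdges (sphereSection u v a), Supports a S F}

lemma convex_sphereSection : Convex ℝ (sphereSection u v a) :=
  (convex_convexHull ℝ _).inter (Submodule.convex _)

/-- The point `comb a d` is an endpoint of a segment in the section that has `comb a c` in its open
part, so extremality of `F` applies. The other endpoint lies in the plane because it is a linear
combination of two points of the plane. -/
lemma comb_mem_edge {S T : Finset (Fin m)} {c d : Fin m → ℝ} (hc : PosWeights S c)
    (hd : PosWeights T d) (hTS : T ⊆ S) (hF : F ∈ polytopeEdges (sphereSection u v a))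
    (hcF : comb a c ∈ F) (hdV : comb a d ∈ Submodule.span ℝ {u, v}) : comb a d ∈ F := by
  obtain ⟨t, ht0, ht1, y, hy, hEq⟩ := exists_comb_eq (a := a) hc hd hTS
  have hFe := isExtreme_of_mem_polytopeEdges hF
  have hyV : y ∈ Submodule.span ℝ {u, v} := by
    have h1 : (1 - t) • y ∈ Submodule.span ℝ {u, v} := by
      have : (1 - t) • y = comb a c - t • comb a d := by rw [hEq]; abel
      rw [this]
      exact Submodule.sub_mem _ (hFe.subset hcF).2 (Submodule.smul_mem _ _ hdV)
    exact (Submodule.smul_mem_iff _ (by linarith)).1 h1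
  exact hFe.left_mem_of_mem_openSegment ⟨comb_mem_spherePolytope hd.mem_stdSimplex, hdV⟩ ⟨hy, hyV⟩
    hcF ⟨t, 1 - t, ht0, by linarith, by ring, hEq.symm⟩

lemma midpoint_mem_of_mem_polytopeEdges (hQ : Convex ℝ Q) (hF : F ∈ polytopeEdges Q)
    (hp : p ∈ F) (hq : q ∈ F) : midpoint ℝ p q ∈ F := by
  have : Convex ℝ F := hF.2.1.convex hQ
  exact this.midpoint_mem hp hq

lemma eq_of_supports_subset {S T : Finset (Fin m)} (hTS : T ⊆ S)
    (hF : F ∈ polytopeEdges (sphereSection u v a)) (hG : G ∈ polytopeEdges (sphereSection u v a))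
    (hS : Supports a S F) (hT : Supports a T G) : G = F := by
  obtain ⟨p, hp, q, hq, hpq, c, hc, hpc⟩ := hS
  obtain ⟨p', hp', q', hq', hpq', d, hd, hpd⟩ := hT
  have h1 := midpoint_mem_of_mem_polytopeEdges convex_sphereSection hF hp hq
  have h2 := midpoint_mem_of_mem_polytopeEdges convex_sphereSection hG hp' hq'
  refine eq_of_midpoint_mem hG hF hpq' hp' hq' ?_
  rw [hpd] at h2 ⊢
  rw [hpc] at h1
  exact comb_mem_edge hc hd hTS hF h1 ((isExtreme_of_mem_polytopeEdges hG).subset h2).2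

/-- Averaging the two weights gives the midpoint of `midpoint p p'` and `midpoint q q'`. If these
two coincide, exchange `p'` and `q'`: were they to coincide again, adding the two equations would
force `p = q`. -/
lemma Supports.union {S T : Finset (Fin m)} (hQ : Convex ℝ Q) (hF : F ∈ polytopeEdges Q)
    (hS : Supports a S F) (hT : Supports a T F) : Supports a (S ∪ T) F := by
  classical
  obtain ⟨p, hp, q, hq, hpq, c, hc, hpc⟩ := hS
  obtain ⟨p', hp', q', hq', hpq', d, hd, hpd⟩ := hT
  have hFc : Convex ℝ F := hF.2.1.convex hQ
  have key : ∀ p' ∈ F, ∀ q' ∈ F, midpoint ℝ p' q' = comb a d →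
      midpoint ℝ p p' ≠ midpoint ℝ q q' → Supports a (S ∪ T) F := by
    intro p' hp' q' hq' hpd hne
    refine ⟨midpoint ℝ p p', hFc.midpoint_mem hp hp', midpoint ℝ q q', hFc.midpoint_mem hq hq', hne,
      fun i => (1 / 2) * c i + (1 / 2) * d i, ⟨?_, ?_, ?_⟩, ?_⟩
    · intro i hi
      have h1 := hc.nonneg i
      have h2 := hd.nonneg i
      rcases Finset.mem_union.1 hi with h | h
      · linarith [hc.pos i h]
      · linarith [hd.pos i h]
    · intro i hi
      rw [Finset.mem_union, not_or] at hi
      rw [hc.zero i hi.1, hd.zero i hi.2]; norm_num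
    · rw [Finset.sum_add_distrib, ← Finset.mul_sum, ← Finset.mul_sum, hc.sum, hd.sum]; norm_num
    · rw [comb_add_smul, ← hpc, ← hpd]
      simp only [midpoint_eq_smul_add, smul_add]
      norm_num
      abel
  by_cases h : midpoint ℝ p p' = midpoint ℝ q q'
  · refine key q' hq' p' hp' (by rw [midpoint_comm, hpd]) ?_
    intro h'
    rw [midpoint_eq_smul_add, midpoint_eq_smul_add] at h h'
    have e1 := smul_right_injective _ (by norm_num : (⅟2 : ℝ) ≠ 0) h
    have e2 := smul_right_injective _ (by norm_num : (⅟2 : ℝ) ≠ 0) h'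
    apply hpq
    have e3 : (2 : ℝ) • p = (2 : ℝ) • q := by
      have : (p + p') + (p + q') = (q + q') + (q + p') := by rw [e1, e2]
      rw [two_smul, two_smul]
      have h4 : p + p + (p' + q') = q + q + (p' + q') := by
        calc _ = (p + p') + (p + q') := by abel
          _ = _ := by rw [this]; abel
      exact add_right_cancel h4
    exact smul_right_injective _ (by norm_num : (2 : ℝ) ≠ 0) e3
  · exact key p' hp' q' hq' hpd h

lemma exists_supports (hF : F ∈ polytopeEdges (sphereSection u v a)) :
    ∃ S : Finset (Fin m), S.card ≤ n + 1 ∧ Supports a S F := by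
  obtain ⟨p, hp, q, hq, hpq⟩ := exists_pair_of_mem_polytopeEdges hF
  have h1 := (isExtreme_of_mem_polytopeEdges hF).subset
    (midpoint_mem_of_mem_polytopeEdges convex_sphereSection hF hp hq)
  obtain ⟨S, c, hS, hc, hcx⟩ := exists_posWeights_card_le h1.1
  exact ⟨S, hS, p, hp, q, hq, hpq, c, hc, hcx.symm⟩

/-- The edges of the section are at most as many as the small edge supports. -/
lemma encard_polytopeEdges_le :
    (polytopeEdges (sphereSection u v a)).encard ≤
      {S ∈ edgeSupports u v a | S.card ≤ n + 1}.encard := by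
  choose! f hf using fun F (hF : F ∈ polytopeEdges (sphereSection u v a)) => exists_supports hF
  refine encard_le_encard_of_injOn (f := f) (fun F hF => ⟨⟨F, hF, (hf F hF).2⟩, (hf F hF).1⟩) ?_
  intro F hF G hG hFG
  exact eq_of_supports_subset (by rw [hFG]) hG hF (hf G hG).2 (hf F hF).2

/-- The number of edges of the section is a function of its set of edge supports. -/
lemma encard_polytopeEdges_eq :
    (polytopeEdges (sphereSection u v a)).encard =
      ((fun S => {T ∈ edgeSupports u v a | S ∪ T ∈ edgeSupports u v a}) ''
        edgeSupports u v a).encard := by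
  classical
  -- Two supports belong to the same edge exactly when their union is again a support, so the edges
  -- are recovered as classes of supports.
  have hchar : ∀ F ∈ polytopeEdges (sphereSection u v a), ∀ S, Supports a S F →
      {T ∈ edgeSupports u v a | S ∪ T ∈ edgeSupports u v a} = {T | Supports a T F} := by
    intro F hF S hS
    ext T
    constructor
    · rintro ⟨⟨G, hG, hT⟩, ⟨H, hH, hST⟩⟩
      have h1 := eq_of_supports_subset Finset.subset_union_left hH hF hST hS
      have h2 := eq_of_supports_subset Finset.subset_union_right hH hG hST hT
      rw [mem_ofPred_eq, h1, ← h2]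
      exact hT
    · intro hT
      exact ⟨⟨F, hF, hT⟩, ⟨F, hF, hS.union convex_sphereSection hF hT⟩⟩
  have himg : ((fun S => {T ∈ edgeSupports u v a | S ∪ T ∈ edgeSupports u v a}) ''
      edgeSupports u v a) =
      (fun F => {T | Supports a T F}) '' polytopeEdges (sphereSection u v a) := by
    ext A
    constructor
    · rintro ⟨S, ⟨F, hF, hS⟩, rfl⟩
      exact ⟨F, hF, (hchar F hF S hS).symm⟩
    · rintro ⟨F, hF, rfl⟩
      obtain ⟨S, -, hS⟩ := exists_supports hF
      exact ⟨S, ⟨F, hF, hS⟩, hchar F hF S hS⟩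
  rw [himg, InjOn.encard_image]
  intro F hF G hG hFG
  obtain ⟨S, -, hS⟩ := exists_supports hF
  have : S ∈ {T | Supports a T G} := by
    have h : S ∈ {T | Supports a T F} := hS
    exact (show {T | Supports a T F} = {T | Supports a T G} from hFG) ▸ h
  exact eq_of_supports_subset subset_rfl hG hF this hS

end

/-! ### Measurability of the number of edges -/

noncomputable section

variable {n m : ℕ} {a : Fin m → Metric.sphere (0 : EuclideanSpace ℝ (Fin n)) 1}
variable {u v : EuclideanSpace ℝ (Fin n)}

lemma finrank_span_insert_pair (huv : LinearIndependent ℝ ![u, v]) :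
    Module.finrank ℝ (Submodule.span ℝ {u, v}) = 2 := by
  have := finrank_span_eq_card huv
  rwa [Matrix.range_cons_cons_empty, Fintype.card_fin] at this

/-- The midpoint of some two distinct points of the section is a strictly positive combination of
the points with index in `S`. -/
def MeetsMidpoint (u v : EuclideanSpace ℝ (Fin n))
    (a : Fin m → Metric.sphere (0 : EuclideanSpace ℝ (Fin n)) 1) (S : Finset (Fin m)) : Prop :=
  ∃ p ∈ sphereSection u v a, ∃ q ∈ sphereSection u v a, p ≠ q ∧
    ∃ c, PosWeights S c ∧ midpoint ℝ p q = comb a c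

/-- Some strictly positive combination of the points with index in `S` is the centre of a
parallelogram with diagonals parallel to `u` and `v` contained in the section. -/
def MeetsInterior (u v : EuclideanSpace ℝ (Fin n))
    (a : Fin m → Metric.sphere (0 : EuclideanSpace ℝ (Fin n)) 1) (S : Finset (Fin m)) : Prop :=
  ∃ k : ℕ, ∃ c, PosWeights S c ∧ comb a c ∈ Submodule.span ℝ {u, v} ∧
    comb a c + (1 / ((k : ℝ) + 1)) • u ∈ spherePolytope a ∧
    comb a c - (1 / ((k : ℝ) + 1)) • u ∈ spherePolytope a ∧
    comb a c + (1 / ((k : ℝ) + 1)) • v ∈ spherePolytope a ∧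
    comb a c - (1 / ((k : ℝ) + 1)) • v ∈ spherePolytope a

lemma add_sub_mem_of_isExtreme {Q F : Set (EuclideanSpace ℝ (Fin n))} (hF : IsExtreme ℝ Q F)
    {x w : EuclideanSpace ℝ (Fin n)} (hx : x ∈ F) (h1 : x + w ∈ Q) (h2 : x - w ∈ Q) :
    w ∈ vectorSpan ℝ F := by
  have hmid : x ∈ openSegment ℝ (x + w) (x - w) :=
    ⟨1 / 2, 1 / 2, by norm_num, by norm_num, by norm_num, by
      rw [← smul_add, add_add_sub_cancel, ← two_smul ℝ, smul_smul]; norm_num⟩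
  have := vsub_mem_vectorSpan ℝ (hF.left_mem_of_mem_openSegment h1 h2 hx hmid) hx
  simpa using this

/-- Every positive combination over `S` in the plane lies in the edge. A parallelogram around one of
them would put both `u` and `v` in the direction of the edge, which has dimension one. -/
lemma not_meetsInterior_of_mem_edgeSupports (huv : LinearIndependent ℝ ![u, v])
    {S : Finset (Fin m)} (hS : S ∈ edgeSupports u v a) : ¬ MeetsInterior u v a S := by
  rintro ⟨k, d, hd, hdV, h1, h2, h3, h4⟩
  obtain ⟨F, hF, p, hp, q, hq, hpq, c, hc, hpc⟩ := hS
  have hk : (1 / ((k : ℝ) + 1)) ≠ 0 := by positivity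
  have hx := midpoint_mem_of_mem_polytopeEdges convex_sphereSection hF hp hq
  rw [hpc] at hx
  have hdF := comb_mem_edge hc hd subset_rfl hF hx hdV
  have hFe := isExtreme_of_mem_polytopeEdges hF
  have huV : (1 / ((k : ℝ) + 1)) • u ∈ Submodule.span ℝ {u, v} :=
    Submodule.smul_mem _ _ (Submodule.subset_span (by simp))
  have hvV : (1 / ((k : ℝ) + 1)) • v ∈ Submodule.span ℝ {u, v} :=
    Submodule.smul_mem _ _ (Submodule.subset_span (by simp))
  have hu := add_sub_mem_of_isExtreme hFe hdF ⟨h1, Submodule.add_mem _ hdV huV⟩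
    ⟨h2, Submodule.sub_mem _ hdV huV⟩
  have hv := add_sub_mem_of_isExtreme hFe hdF ⟨h3, Submodule.add_mem _ hdV hvV⟩
    ⟨h4, Submodule.sub_mem _ hdV hvV⟩
  rw [Submodule.smul_mem_iff _ hk] at hu hv
  have hle : Submodule.span ℝ {u, v} ≤ vectorSpan ℝ F := by
    rw [Submodule.span_le]
    rintro w (rfl | rfl)
    exacts [hu, hv]
  have := Submodule.finrank_mono hle
  rw [finrank_span_insert_pair huv, hF.2.2] at this
  omega

/-- In the coordinates `φ` of the plane, the midpoint is not interior to the preimage of `P`, so a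
nonzero functional is maximal there, and therefore at `p` and `q` too. The face it exposes has
dimension at least one because `p ≠ q`, and less than two because the functional is nonzero on the
plane. -/
lemma mem_edgeSupports_of_not_meetsInterior (huv : LinearIndependent ℝ ![u, v])
    {S : Finset (Fin m)} (hA : MeetsMidpoint u v a S) (hB : ¬ MeetsInterior u v a S) :
    S ∈ edgeSupports u v a := by
  obtain ⟨p, hp, q, hq, hpq, c, hc, hpc⟩ := hA
  let φ : ℝ × ℝ →ₗ[ℝ] EuclideanSpace ℝ (Fin n) :=
    (LinearMap.fst ℝ ℝ ℝ).smulRight u + (LinearMap.snd ℝ ℝ ℝ).smulRight v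
  have hφ : ∀ z, φ z = z.1 • u + z.2 • v := fun z => rfl
  have hφV : ∀ z, φ z ∈ Submodule.span ℝ {u, v} := fun z =>
    Submodule.mem_span_pair.2 ⟨z.1, z.2, rfl⟩
  have hker : LinearMap.ker φ = ⊥ := by
    rw [LinearMap.ker_eq_bot']
    intro z hz
    have := LinearIndependent.pair_iff.1 huv z.1 z.2 hz
    exact Prod.ext this.1 this.2
  obtain ⟨ψ, hψ⟩ := φ.exists_leftInverse_of_injective hker
  have hψφ : ∀ z, ψ (φ z) = z := fun z => LinearMap.congr_fun hψ z
  have hxQ : midpoint ℝ p q ∈ sphereSection u v a := convex_sphereSection.midpoint_mem hp hq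
  obtain ⟨s, t, hst⟩ := Submodule.mem_span_pair.1 hxQ.2
  have hz0 : φ (s, t) = midpoint ℝ p q := hst
  let K : Set (ℝ × ℝ) := φ ⁻¹' (spherePolytope a)
  have hKc : Convex ℝ K := (convex_convexHull ℝ _).linear_preimage φ
  have hzK : (s, t) ∈ K := by
    change φ (s, t) ∈ spherePolytope a
    rw [hz0]; exact hxQ.1
  have hzi : (s, t) ∉ interior K := by
    intro hint
    obtain ⟨ε, hε, hball⟩ := Metric.isOpen_iff.1 isOpen_interior _ hint
    obtain ⟨k, hk⟩ := exists_nat_one_div_lt hε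
    have hk0 : 0 < 1 / ((k : ℝ) + 1) := by positivity
    have hmem : ∀ x y : ℝ, |x| < ε → |y| < ε → comb a c + (x • u + y • v) ∈ spherePolytope a := by
      intro x y hx hy
      have : (s + x, t + y) ∈ K := interior_subset (hball (by
        rw [Metric.mem_ball, Prod.dist_eq, Real.dist_eq, Real.dist_eq]
        simpa using ⟨hx, hy⟩))
      have h2 : φ (s + x, t + y) = comb a c + (x • u + y • v) := by
        rw [← hpc, ← hz0, hφ, hφ]
        simp only [add_smul]
        abel
      rw [← h2]
      exact this
    refine hB ⟨k, c, hc, hpc ▸ hxQ.2, ?_, ?_, ?_, ?_⟩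
    · simpa using hmem (1 / ((k : ℝ) + 1)) 0 (by rwa [abs_of_pos hk0]) (by simpa using hε)
    · have := hmem (-(1 / ((k : ℝ) + 1))) 0 (by rwa [abs_neg, abs_of_pos hk0]) (by simpa using hε)
      rwa [zero_smul, add_zero, neg_smul, ← sub_eq_add_neg] at this
    · simpa using hmem 0 (1 / ((k : ℝ) + 1)) (by simpa using hε) (by rwa [abs_of_pos hk0])
    · have := hmem 0 (-(1 / ((k : ℝ) + 1))) (by simpa using hε) (by rwa [abs_neg, abs_of_pos hk0])
      rwa [zero_smul, zero_add, neg_smul, ← sub_eq_add_neg] at this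
  obtain ⟨f, hf0, hf⟩ := hKc.exists_support_of_notMem_interior hzK hzi
  -- A left inverse of `φ` extends the functional from the plane to the whole space, as exposedness
  -- requires.
  let l : EuclideanSpace ℝ (Fin n) →L[ℝ] ℝ :=
    LinearMap.toContinuousLinearMap (f.toLinearMap.comp ψ)
  have hl : ∀ z, l (φ z) = f z := fun z => by
    change f (ψ (φ z)) = f z
    rw [hψφ]
  have hmax : ∀ y ∈ sphereSection u v a, l y ≤ l (midpoint ℝ p q) := by
    intro y hy
    obtain ⟨s', t', hy'⟩ := Submodule.mem_span_pair.1 hy.2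
    have hy'' : φ (s', t') = y := hy'
    rw [← hz0, hl, ← hy'', hl]
    exact hf _ (by change φ (s', t') ∈ spherePolytope a; rw [hy'']; exact hy.1)
  have hlmid : l (midpoint ℝ p q) = (l p + l q) / 2 := by
    rw [midpoint_eq_smul_add, map_smul, map_add, smul_eq_mul, invOf_eq_inv]
    ring
  have h1 := hmax p hp
  have h2 := hmax q hq
  let F := {z | z ∈ sphereSection u v a ∧ ∀ y ∈ sphereSection u v a, l y ≤ l z}
  have hpF : p ∈ F := ⟨hp, fun y hy => (hmax y hy).trans (by linarith)⟩
  have hqF : q ∈ F := ⟨hq, fun y hy => (hmax y hy).trans (by linarith)⟩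
  refine ⟨F, ⟨⟨p, hpF⟩, fun _ => ⟨l, rfl⟩, ?_⟩, p, hpF, q, hqF, hpq, c, hc, hpc⟩
  have hle : vectorSpan ℝ F ≤ Submodule.span ℝ {u, v} ⊓ LinearMap.ker l.toLinearMap := by
    rw [vectorSpan_def, Submodule.span_le]
    rintro _ ⟨y, hy, z, hz, rfl⟩
    refine ⟨Submodule.sub_mem _ hy.1.2 hz.1.2, ?_⟩
    have h3 := hy.2 z hz.1
    have h4 := hz.2 y hy.1
    change l (y - z) = 0
    rw [map_sub]
    linarith
  have hlt : Submodule.span ℝ {u, v} ⊓ LinearMap.ker l.toLinearMap < Submodule.span ℝ {u, v} := by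
    refine lt_of_le_of_ne inf_le_left fun h => hf0 ?_
    refine ContinuousLinearMap.ext fun z => ?_
    have : φ z ∈ Submodule.span ℝ {u, v} ⊓ LinearMap.ker l.toLinearMap := by
      rw [h]; exact hφV z
    rw [← hl z]
    exact this.2
  have h3 := Submodule.finrank_lt_finrank_of_lt (lt_of_le_of_lt hle hlt)
  rw [finrank_span_insert_pair huv] at h3
  have h4 : Module.finrank ℝ (vectorSpan ℝ F) ≠ 0 := by
    rw [Ne, Submodule.finrank_eq_zero]
    intro h
    have := vsub_mem_vectorSpan ℝ hpF hqF
    rw [h, Submodule.mem_bot, vsub_eq_sub, sub_eq_zero] at this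
    exact hpq this
  omega

lemma mem_edgeSupports_iff (huv : LinearIndependent ℝ ![u, v]) {S : Finset (Fin m)} :
    S ∈ edgeSupports u v a ↔ MeetsMidpoint u v a S ∧ ¬ MeetsInterior u v a S := by
  refine ⟨fun h => ⟨?_, not_meetsInterior_of_mem_edgeSupports huv h⟩,
    fun h => mem_edgeSupports_of_not_meetsInterior huv h.1 h.2⟩
  obtain ⟨F, hF, p, hp, q, hq, h⟩ := h
  have := (isExtreme_of_mem_polytopeEdges hF).subset
  exact ⟨p, this hp, q, this hq, h⟩

/-- Replaces the open conditions `0 < c i` by a countable union of closed ones, for use with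
compactness of the simplex. -/
lemma exists_nat_posWeights_iff {S : Finset (Fin m)} {c : Fin m → ℝ} :
    PosWeights S c ↔ c ∈ stdSimplex ℝ (Fin m) ∧
      ∃ k : ℕ, ((∀ i ∈ S, 1 / ((k : ℝ) + 1) ≤ c i) ∧ ∀ i ∉ S, c i = 0) := by
  constructor
  · intro h
    refine ⟨h.mem_stdSimplex, ?_⟩
    obtain ⟨i₀, hi₀, hmin⟩ := S.exists_min_image c h.nonempty
    obtain ⟨k, hk⟩ := exists_nat_one_div_lt (h.pos i₀ hi₀)
    exact ⟨k, fun i hi => hk.le.trans (hmin i hi), h.zero⟩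
  · rintro ⟨h, k, h1, h2⟩
    exact ⟨fun i hi => lt_of_lt_of_le (by positivity) (h1 i hi), h2, h.2⟩

lemma continuous_comb {X : Type*} [TopologicalSpace X]
    {f : X → Fin m → Metric.sphere (0 : EuclideanSpace ℝ (Fin n)) 1} {c : X → Fin m → ℝ}
    (hf : Continuous f) (hc : Continuous c) : Continuous fun x => comb (f x) (c x) := by
  unfold comb
  fun_prop

lemma IsClosed.setOf_exists_compact {X Y : Type*} [TopologicalSpace X] [TopologicalSpace Y]
    [CompactSpace Y] {C : Set (X × Y)} (hC : IsClosed C) : IsClosed {x | ∃ y, (x, y) ∈ C} := by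
  have := isClosedMap_fst_of_compactSpace (X := X) (Y := Y) _ hC
  convert this using 1
  ext x
  simp

lemma isClosed_posWeights {X : Type*} [TopologicalSpace X] {c : X → Fin m → ℝ}
    (hc : Continuous c) (S : Finset (Fin m)) (k : ℕ) :
    IsClosed {x | (∀ i ∈ S, 1 / ((k : ℝ) + 1) ≤ c x i) ∧ ∀ i ∉ S, c x i = 0} := by
  have h : {x | (∀ i ∈ S, 1 / ((k : ℝ) + 1) ≤ c x i) ∧ ∀ i ∉ S, c x i = 0} =
      (⋂ i ∈ S, {x | 1 / ((k : ℝ) + 1) ≤ c x i}) ∩ ⋂ i ∉ S, {x | c x i = 0} := by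
    ext x; simp
  rw [h]
  exact (isClosed_biInter fun i _ => isClosed_le continuous_const (by fun_prop)).inter
    (isClosed_biInter fun i _ => isClosed_eq (by fun_prop) continuous_const)

/-- For fixed lower bounds on the weights and on the distance of the two points, the event is the
projection of a closed set along a compact product of simplices, hence closed. The event itself is a
countable union of these. -/
lemma measurableSet_meetsMidpoint (S : Finset (Fin m)) :
    MeasurableSet {a : Fin m → Metric.sphere (0 : EuclideanSpace ℝ (Fin n)) 1 |
      MeetsMidpoint u v a S} := by
  have : CompactSpace (stdSimplex ℝ (Fin m)) :=
    isCompact_iff_compactSpace.1 (isCompact_stdSimplex ℝ (Fin m))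
  let Δ := stdSimplex ℝ (Fin m)
  have h : {a : Fin m → Metric.sphere (0 : EuclideanSpace ℝ (Fin n)) 1 | MeetsMidpoint u v a S} =
      ⋃ (k : ℕ) (j : ℕ), {a | ∃ y : Δ × Δ × Δ, (a, y) ∈
        {z : (Fin m → Metric.sphere (0 : EuclideanSpace ℝ (Fin n)) 1) × Δ × Δ × Δ |
        ((∀ i ∈ S, 1 / ((k : ℝ) + 1) ≤ z.2.1.1 i) ∧ ∀ i ∉ S, z.2.1.1 i = 0) ∧
        comb z.1 z.2.2.1 ∈ (Submodule.span ℝ {u, v} : Set (EuclideanSpace ℝ (Fin n))) ∧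
        comb z.1 z.2.2.2 ∈ (Submodule.span ℝ {u, v} : Set (EuclideanSpace ℝ (Fin n))) ∧
        1 / ((j : ℝ) + 1) ≤ dist (comb z.1 z.2.2.1) (comb z.1 z.2.2.2) ∧
        midpoint ℝ (comb z.1 z.2.2.1) (comb z.1 z.2.2.2) = comb z.1 z.2.1}} := by
    ext a
    simp only [mem_iUnion, mem_ofPred_eq]
    constructor
    · rintro ⟨p, ⟨hp, hpV⟩, q, ⟨hq, hqV⟩, hpq, c, hc, hpc⟩
      obtain ⟨d, hd, rfl⟩ := mem_spherePolytope_iff.1 hp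
      obtain ⟨e, he, rfl⟩ := mem_spherePolytope_iff.1 hq
      obtain ⟨hcΔ, k, hk⟩ := exists_nat_posWeights_iff.1 hc
      obtain ⟨j, hj⟩ := exists_nat_one_div_lt (dist_pos.2 hpq)
      exact ⟨k, j, (⟨c, hcΔ⟩, ⟨d, hd⟩, ⟨e, he⟩), hk, hpV, hqV, hj.le, hpc⟩
    · rintro ⟨k, j, ⟨c, d, e⟩, hk, hpV, hqV, hj, hpc⟩
      refine ⟨comb a d, ⟨comb_mem_spherePolytope d.2, hpV⟩, comb a e,
        ⟨comb_mem_spherePolytope e.2, hqV⟩, ?_, c, exists_nat_posWeights_iff.2 ⟨c.2, k, hk⟩, hpc⟩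
      exact dist_pos.1 (lt_of_lt_of_le (by positivity) hj)
  rw [h]
  refine MeasurableSet.iUnion fun k => MeasurableSet.iUnion fun j => IsClosed.measurableSet ?_
  have hV : IsClosed (Submodule.span ℝ {u, v} : Set (EuclideanSpace ℝ (Fin n))) :=
    Submodule.closed_of_finiteDimensional _
  have c1 : Continuous fun z : (Fin m → Metric.sphere (0 : EuclideanSpace ℝ (Fin n)) 1) × Δ × Δ × Δ
    => comb z.1 z.2.1 := continuous_comb (by fun_prop) (by fun_prop)
  have c2 : Continuous fun z : (Fin m → Metric.sphere (0 : EuclideanSpace ℝ (Fin n)) 1) × Δ × Δ × Δ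
    => comb z.1 z.2.2.1 := continuous_comb (by fun_prop) (by fun_prop)
  have c3 : Continuous fun z : (Fin m → Metric.sphere (0 : EuclideanSpace ℝ (Fin n)) 1) × Δ × Δ × Δ
    => comb z.1 z.2.2.2 := continuous_comb (by fun_prop) (by fun_prop)
  refine IsClosed.setOf_exists_compact ?_
  refine (isClosed_posWeights (by fun_prop) S k).inter ((hV.preimage c2).inter
    ((hV.preimage c3).inter ((isClosed_le continuous_const (c2.dist c3)).inter
      (isClosed_eq ?_ c1))))
  simp only [midpoint_eq_smul_add]
  fun_prop

lemma measurableSet_meetsInterior (S : Finset (Fin m)) :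
    MeasurableSet {a : Fin m → Metric.sphere (0 : EuclideanSpace ℝ (Fin n)) 1 |
      MeetsInterior u v a S} := by
  have : CompactSpace (stdSimplex ℝ (Fin m)) :=
    isCompact_iff_compactSpace.1 (isCompact_stdSimplex ℝ (Fin m))
  let Δ := stdSimplex ℝ (Fin m)
  let X := Fin m → Metric.sphere (0 : EuclideanSpace ℝ (Fin n)) 1
  have h : {a : X | MeetsInterior u v a S} =
      ⋃ (k : ℕ) (j : ℕ), {a | ∃ y : Δ × Δ × Δ × Δ × Δ, (a, y) ∈
        {z : X × Δ × Δ × Δ × Δ × Δ |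
        ((∀ i ∈ S, 1 / ((j : ℝ) + 1) ≤ z.2.1.1 i) ∧ ∀ i ∉ S, z.2.1.1 i = 0) ∧
        comb z.1 z.2.1 ∈ (Submodule.span ℝ {u, v} : Set (EuclideanSpace ℝ (Fin n))) ∧
        comb z.1 z.2.2.1 = comb z.1 z.2.1 + (1 / ((k : ℝ) + 1)) • u ∧
        comb z.1 z.2.2.2.1 = comb z.1 z.2.1 - (1 / ((k : ℝ) + 1)) • u ∧
        comb z.1 z.2.2.2.2.1 = comb z.1 z.2.1 + (1 / ((k : ℝ) + 1)) • v ∧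
        comb z.1 z.2.2.2.2.2 = comb z.1 z.2.1 - (1 / ((k : ℝ) + 1)) • v}} := by
    ext a
    simp only [mem_iUnion, mem_ofPred_eq]
    constructor
    · rintro ⟨k, c, hc, hV, h1, h2, h3, h4⟩
      obtain ⟨d1, hd1, h1⟩ := mem_spherePolytope_iff.1 h1
      obtain ⟨d2, hd2, h2⟩ := mem_spherePolytope_iff.1 h2
      obtain ⟨d3, hd3, h3⟩ := mem_spherePolytope_iff.1 h3
      obtain ⟨d4, hd4, h4⟩ := mem_spherePolytope_iff.1 h4
      obtain ⟨hcΔ, j, hj⟩ := exists_nat_posWeights_iff.1 hc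
      exact ⟨k, j, (⟨c, hcΔ⟩, ⟨d1, hd1⟩, ⟨d2, hd2⟩, ⟨d3, hd3⟩, ⟨d4, hd4⟩), hj, hV, h1, h2, h3, h4⟩
    · rintro ⟨k, j, ⟨c, d1, d2, d3, d4⟩, hj, hV, h1, h2, h3, h4⟩
      exact ⟨k, c, exists_nat_posWeights_iff.2 ⟨c.2, j, hj⟩, hV,
        mem_spherePolytope_iff.2 ⟨d1, d1.2, h1⟩, mem_spherePolytope_iff.2 ⟨d2, d2.2, h2⟩,
        mem_spherePolytope_iff.2 ⟨d3, d3.2, h3⟩, mem_spherePolytope_iff.2 ⟨d4, d4.2, h4⟩⟩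
  change MeasurableSet {a : X | MeetsInterior u v a S}
  rw [h]
  refine MeasurableSet.iUnion fun k => MeasurableSet.iUnion fun j => IsClosed.measurableSet ?_
  have hV : IsClosed (Submodule.span ℝ {u, v} : Set (EuclideanSpace ℝ (Fin n))) :=
    Submodule.closed_of_finiteDimensional _
  have c0 : Continuous fun z : X × Δ × Δ × Δ × Δ × Δ => comb z.1 z.2.1 :=
    continuous_comb (by fun_prop) (by fun_prop)
  have c1 : Continuous fun z : X × Δ × Δ × Δ × Δ × Δ => comb z.1 z.2.2.1 :=
    continuous_comb (by fun_prop) (by fun_prop)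
  have c2 : Continuous fun z : X × Δ × Δ × Δ × Δ × Δ => comb z.1 z.2.2.2.1 :=
    continuous_comb (by fun_prop) (by fun_prop)
  have c3 : Continuous fun z : X × Δ × Δ × Δ × Δ × Δ => comb z.1 z.2.2.2.2.1 :=
    continuous_comb (by fun_prop) (by fun_prop)
  have c4 : Continuous fun z : X × Δ × Δ × Δ × Δ × Δ => comb z.1 z.2.2.2.2.2 :=
    continuous_comb (by fun_prop) (by fun_prop)
  refine IsClosed.setOf_exists_compact ?_
  exact (isClosed_posWeights (by fun_prop) S j).inter ((hV.preimage c0).inter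
    ((isClosed_eq c1 (c0.add continuous_const)).inter
    ((isClosed_eq c2 (c0.sub continuous_const)).inter
    ((isClosed_eq c3 (c0.add continuous_const)).inter
    (isClosed_eq c4 (c0.sub continuous_const))))))

lemma measurableSet_mem_edgeSupports (huv : LinearIndependent ℝ ![u, v]) (S : Finset (Fin m)) :
    MeasurableSet {a : Fin m → Metric.sphere (0 : EuclideanSpace ℝ (Fin n)) 1 |
      S ∈ edgeSupports u v a} := by
  simp_rw [mem_edgeSupports_iff huv]
  exact (measurableSet_meetsMidpoint S).diff (measurableSet_meetsInterior S)

lemma measurable_sectionEdgeCount (huv : LinearIndependent ℝ ![u, v]) :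
    Measurable (sectionEdgeCount (n := n) (m := m) u v) := by
  classical
  let g : (Finset (Fin m) → Prop) → ENNReal := fun R =>
    (((fun S => {T | R T ∧ R (S ∪ T)}) '' {S | R S}).encard : ENNReal)
  have hg : sectionEdgeCount (n := n) (m := m) u v =
      fun a => g fun S => S ∈ edgeSupports u v a := by
    ext a
    change ((polytopeEdges (sphereSection u v a)).encard : ENNReal) = _
    rw [encard_polytopeEdges_eq]
    rfl
  rw [hg]
  exact (measurable_of_finite g).comp
    (measurable_pi_lambda _ fun S => measurable_to_prop (by
      convert measurableSet_mem_edgeSupports (n := n) huv S using 1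
      ext; simp))

end

/-! ### Measure of spherical caps, and nets of the sphere -/

noncomputable section

open scoped Pointwise in
lemma sphereUniform_apply {n : ℕ} (hn : 1 ≤ n)
    {s : Set (Metric.sphere (0 : EuclideanSpace ℝ (Fin n)) 1)} (hs : MeasurableSet s) :
    sphereUniform n s = volume (Ioo (0 : ℝ) 1 • (Subtype.val '' s)) /
      volume (Metric.ball (0 : EuclideanSpace ℝ (Fin n)) 1) := by
  have : Nonempty (Fin n) := ⟨⟨0, hn⟩⟩
  have h0 : (n : ENNReal) ≠ 0 := by exact_mod_cast (by omega : n ≠ 0)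
  rw [sphereUniform, Measure.smul_apply, Measure.toSphere_apply_univ, Measure.toSphere_apply' _ hs,
    finrank_euclideanSpace_fin, smul_eq_mul, ← ENNReal.div_eq_inv_mul]
  exact ENNReal.mul_div_mul_left _ _ h0 (by simp)

lemma isProbabilityMeasure_sphereUniform {n : ℕ} (hn : 1 ≤ n) :
    IsProbabilityMeasure (sphereUniform n) := by
  have : Nonempty (Fin n) := ⟨⟨0, hn⟩⟩
  constructor
  rw [sphereUniform, Measure.smul_apply, smul_eq_mul]
  refine ENNReal.inv_mul_cancel ?_ (measure_ne_top _ _)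
  rw [Ne, Measure.measure_univ_eq_zero]
  exact Measure.toSphere_ne_zero _

lemma volume_ball_div {n : ℕ} (x : EuclideanSpace ℝ (Fin n)) {r : ℝ} (hr : 0 < r) :
    volume (Metric.ball x r) / volume (Metric.ball (0 : EuclideanSpace ℝ (Fin n)) 1) =
      ENNReal.ofReal (r ^ n) := by
  rw [Measure.addHaar_ball_of_pos _ x hr, finrank_euclideanSpace_fin]
  exact ENNReal.mul_div_cancel_right (Metric.measure_ball_pos _ _ one_pos).ne'
    measure_ball_lt_top.ne

open scoped Pointwise in
/-- A spherical cap of radius `ρ` has measure at most a constant times `ρ ^ (n - 1)`. -/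
lemma sphereUniform_ball_le {n : ℕ} (hn : 1 ≤ n) (c : Metric.sphere (0 : EuclideanSpace ℝ (Fin n)) 1)
    {ρ : ℝ} (hρ : 0 < ρ) :
    sphereUniform n (Metric.ball c ρ) ≤ ENNReal.ofReal (3 * 2 ^ n * ρ ^ (n - 1)) := by
  have hprob := isProbabilityMeasure_sphereUniform hn
  rcases le_or_gt ρ 1 with h1 | h1
  swap
  · refine prob_le_one.trans ?_
    rw [← ENNReal.ofReal_one]
    refine ENNReal.ofReal_le_ofReal ?_
    have h2 : (1 : ℝ) ≤ 2 ^ n := one_le_pow₀ (by norm_num)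
    have h3 : (1 : ℝ) ≤ ρ ^ (n - 1) := one_le_pow₀ h1.le
    nlinarith
  rw [sphereUniform_apply hn measurableSet_ball]
  -- The cone over the cap is covered by balls of radius `2 * ρ` centred at steps of `ρ` along its
  -- axis, of which there are at most `2 / ρ`.
  set N := ⌊1 / ρ⌋₊ + 1 with hN
  have hc : ‖(c : EuclideanSpace ℝ (Fin n))‖ = 1 := by simp
  have hsub : Ioo (0 : ℝ) 1 • (Subtype.val '' Metric.ball c ρ) ⊆
      ⋃ k ∈ Finset.range N, Metric.ball (((k : ℝ) * ρ) • (c : EuclideanSpace ℝ (Fin n))) (2 * ρ) := by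
    rintro _ ⟨t, ht, _, ⟨a, ha, rfl⟩, rfl⟩
    have ha' : ‖(a : EuclideanSpace ℝ (Fin n)) - c‖ < ρ := by
      rw [← dist_eq_norm]; exact ha
    have ht0 : 0 ≤ t / ρ := div_nonneg ht.1.le hρ.le
    simp only [mem_iUnion, Finset.mem_range]
    refine ⟨⌊t / ρ⌋₊, ?_, ?_⟩
    · rw [hN, Nat.lt_succ_iff]
      exact Nat.floor_le_floor (by gcongr; exact ht.2.le)
    · rw [Metric.mem_ball, dist_eq_norm]
      have e : t • (a : EuclideanSpace ℝ (Fin n)) - ((⌊t / ρ⌋₊ : ℝ) * ρ) • (c : EuclideanSpace ℝ (Fin n))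
          = t • ((a : EuclideanSpace ℝ (Fin n)) - c) + (t - (⌊t / ρ⌋₊ : ℝ) * ρ) • (c : EuclideanSpace ℝ (Fin n)) := by
        rw [smul_sub, sub_smul]; abel
      have hfl := Nat.floor_le ht0
      have hfl2 := Nat.lt_floor_add_one (t / ρ)
      rw [le_div_iff₀ hρ] at hfl
      rw [div_lt_iff₀ hρ] at hfl2
      change ‖t • (a : EuclideanSpace ℝ (Fin n)) - _‖ < _
      rw [e]
      refine (norm_add_le _ _).trans_lt ?_
      rw [norm_smul, norm_smul, hc, mul_one, Real.norm_of_nonneg ht.1.le,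
        Real.norm_of_nonneg (by linarith)]
      have : t * ‖(a : EuclideanSpace ℝ (Fin n)) - c‖ < ρ := by
        nlinarith [ht.1, ht.2, norm_nonneg ((a : EuclideanSpace ℝ (Fin n)) - c)]
      linarith
  calc _ ≤ (∑ k ∈ Finset.range N, volume (Metric.ball (((k : ℝ) * ρ) •
        (c : EuclideanSpace ℝ (Fin n))) (2 * ρ))) /
        volume (Metric.ball (0 : EuclideanSpace ℝ (Fin n)) 1) :=
        ENNReal.div_le_div_right ((measure_mono hsub).trans (measure_biUnion_finset_le _ _)) _
    _ = ∑ k ∈ Finset.range N, ENNReal.ofReal ((2 * ρ) ^ n) := by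
        simp_rw [div_eq_mul_inv, Finset.sum_mul, ← div_eq_mul_inv]
        exact Finset.sum_congr rfl fun k _ => volume_ball_div _ (by positivity)
    _ = ENNReal.ofReal (N * (2 * ρ) ^ n) := by
        rw [Finset.sum_const, Finset.card_range, nsmul_eq_mul, ENNReal.ofReal_mul (by positivity),
          ENNReal.ofReal_natCast]
    _ ≤ _ := by
        refine ENNReal.ofReal_le_ofReal ?_
        have hN' : (N : ℝ) * ρ ≤ 2 := by
          have := Nat.floor_le (by positivity : 0 ≤ 1 / ρ)
          rw [le_div_iff₀ hρ] at this
          rw [hN]; push_cast; linarith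
        obtain ⟨k, rfl⟩ : ∃ k, n = k + 1 := ⟨n - 1, by omega⟩
        have : (N : ℝ) * (2 * ρ) ^ (k + 1) = (N * ρ) * (2 ^ (k + 1) * ρ ^ k) := by ring
        rw [this, Nat.add_sub_cancel, mul_assoc 3]
        exact mul_le_mul_of_nonneg_right (by linarith) (by positivity)

/-- The norm of `y` lies between `3 / 8` and `1`, and normalising moves the direction off `c` by
less than `(ρ / 4) / (3 / 8) < ρ`. -/
lemma ball_subset_cone {n : ℕ} (c : Metric.sphere (0 : EuclideanSpace ℝ (Fin n)) 1)
    {ρ t : ℝ} (hρ : 0 < ρ) (hρ1 : ρ ≤ 1) (ht : 1 / 2 ≤ t) (ht' : t ≤ 7 / 8)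
    {y : EuclideanSpace ℝ (Fin n)}
    (hy : y ∈ Metric.ball (t • (c : EuclideanSpace ℝ (Fin n))) (ρ / 8)) :
    ∃ s ∈ Ioo (0 : ℝ) 1, ∃ b ∈ Metric.ball c ρ, s • (b : EuclideanSpace ℝ (Fin n)) = y := by
  have hc : ‖(c : EuclideanSpace ℝ (Fin n))‖ = 1 := by simp
  rw [Metric.mem_ball, dist_eq_norm] at hy
  have htc : ‖t • (c : EuclideanSpace ℝ (Fin n))‖ = t := by
    rw [norm_smul, hc, mul_one, Real.norm_of_nonneg (by linarith)]
  have h1 : |‖y‖ - t| < ρ / 8 := by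
    have := abs_norm_sub_norm_le y (t • (c : EuclideanSpace ℝ (Fin n)))
    rw [htc] at this
    linarith
  rw [abs_lt] at h1
  have hy0 : 3 / 8 ≤ ‖y‖ := by linarith
  have hypos : 0 < ‖y‖ := by linarith
  refine ⟨‖y‖, ⟨hypos, by linarith⟩, ⟨‖y‖⁻¹ • y, ?_⟩, ?_, ?_⟩
  · rw [mem_sphere_zero_iff_norm, norm_smul, norm_inv, norm_norm, inv_mul_cancel₀ hypos.ne']
  · rw [Metric.mem_ball, Subtype.dist_eq, dist_eq_norm]
    change ‖‖y‖⁻¹ • y - (c : EuclideanSpace ℝ (Fin n))‖ < ρ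
    have e : ‖y‖⁻¹ • y - (c : EuclideanSpace ℝ (Fin n)) =
        ‖y‖⁻¹ • ((y - t • (c : EuclideanSpace ℝ (Fin n))) + (t - ‖y‖) • (c : EuclideanSpace ℝ (Fin n))) := by
      rw [sub_smul, sub_add_sub_cancel, smul_sub, smul_smul, inv_mul_cancel₀ hypos.ne', one_smul]
    rw [e, norm_smul, norm_inv, norm_norm, inv_mul_lt_iff₀ hypos]
    refine (norm_add_le _ _).trans_lt ?_
    rw [norm_smul, hc, mul_one]
    have : ‖t - ‖y‖‖ < ρ / 8 := by rw [Real.norm_eq_abs, abs_lt]; constructor <;> linarith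
    nlinarith
  · change ‖y‖ • ‖y‖⁻¹ • y = y
    rw [smul_smul, mul_inv_cancel₀ hypos.ne', one_smul]

open scoped Pointwise in
/-- A spherical cap of radius `ρ ≤ 1` has measure at least a constant times `ρ ^ (n - 1)`. -/
lemma le_sphereUniform_ball {n : ℕ} (hn : 1 ≤ n) (c : Metric.sphere (0 : EuclideanSpace ℝ (Fin n)) 1)
    {ρ : ℝ} (hρ : 0 < ρ) (hρ1 : ρ ≤ 1) :
    ENNReal.ofReal (3 / 4 / 8 ^ n * ρ ^ (n - 1)) ≤ sphereUniform n (Metric.ball c ρ) := by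
  rw [sphereUniform_apply hn measurableSet_ball]
  -- Disjoint balls of radius `ρ / 8`, at steps of `ρ / 2` along the part of the axis between
  -- heights `1 / 2` and `7 / 8`, all fit in the cone.
  set N := ⌊3 / (4 * ρ)⌋₊ + 1 with hN
  have hc : ‖(c : EuclideanSpace ℝ (Fin n))‖ = 1 := by simp
  let x : ℕ → EuclideanSpace ℝ (Fin n) := fun k => (1 / 2 + k * (ρ / 2)) • (c : EuclideanSpace ℝ (Fin n))
  have hsub : (⋃ k ∈ Finset.range N, Metric.ball (x k) (ρ / 8)) ⊆
      Ioo (0 : ℝ) 1 • (Subtype.val '' Metric.ball c ρ) := by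
    intro y hy
    simp only [mem_iUnion, Finset.mem_range] at hy
    obtain ⟨k, hk, hy⟩ := hy
    have hk' : (k : ℝ) * (4 * ρ) ≤ 3 := by
      rw [← le_div_iff₀ (by positivity)]
      exact (Nat.le_floor_iff (by positivity)).1 (Nat.lt_succ_iff.1 hk)
    obtain ⟨s, hs, b, hb, rfl⟩ := ball_subset_cone c hρ hρ1 (t := 1 / 2 + k * (ρ / 2))
      (by have : 0 ≤ k * (ρ / 2) := by positivity
          linarith) (by linarith) hy
    exact ⟨s, hs, b, ⟨b, hb, rfl⟩, rfl⟩
  have hdisj : (Finset.range N : Set ℕ).PairwiseDisjoint fun k => Metric.ball (x k) (ρ / 8) := by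
    intro k _ j _ hkj
    refine Metric.ball_disjoint_ball ?_
    rw [dist_eq_norm, ← sub_smul, norm_smul, hc, mul_one]
    have e : (1 / 2 + (k : ℝ) * (ρ / 2)) - (1 / 2 + (j : ℝ) * (ρ / 2)) = (((k : ℤ) - (j : ℤ) : ℤ) : ℝ) * (ρ / 2) := by
      push_cast; ring
    rw [e, norm_mul, Real.norm_of_nonneg (by positivity : 0 ≤ ρ / 2), Real.norm_eq_abs]
    have h1 : (1 : ℝ) ≤ |(((k : ℤ) - (j : ℤ) : ℤ) : ℝ)| := by
      rw [← Int.cast_abs]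
      have h2 : (1 : ℤ) ≤ |(k : ℤ) - j| :=
        Int.one_le_abs (sub_ne_zero.2 (fun h => hkj (Int.ofNat_inj.1 h)))
      exact Int.cast_one (R := ℝ) ▸ Int.cast_le.2 h2
    nlinarith
  calc _ ≤ ENNReal.ofReal (N * (ρ / 8) ^ n) := by
        refine ENNReal.ofReal_le_ofReal ?_
        have hN' : 3 / 4 ≤ (N : ℝ) * ρ := by
          have := (Nat.lt_floor_add_one (3 / (4 * ρ))).le
          rw [div_le_iff₀ (by positivity)] at this
          rw [hN]; push_cast; linarith
        obtain ⟨k, rfl⟩ : ∃ k, n = k + 1 := ⟨n - 1, by omega⟩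
        have : (N : ℝ) * (ρ / 8) ^ (k + 1) = (N * ρ) / 8 ^ (k + 1) * ρ ^ k := by
          rw [div_pow]; ring
        rw [this, Nat.add_sub_cancel]
        gcongr
    _ = ∑ k ∈ Finset.range N, ENNReal.ofReal ((ρ / 8) ^ n) := by
        rw [Finset.sum_const, Finset.card_range, nsmul_eq_mul, ENNReal.ofReal_mul (by positivity),
          ENNReal.ofReal_natCast]
    _ = (∑ k ∈ Finset.range N, volume (Metric.ball (x k) (ρ / 8))) /
        volume (Metric.ball (0 : EuclideanSpace ℝ (Fin n)) 1) := by
        simp_rw [div_eq_mul_inv _ (volume _), Finset.sum_mul, ← div_eq_mul_inv _ (volume _)]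
        exact Finset.sum_congr rfl fun k _ => (volume_ball_div _ (by positivity)).symm
    _ ≤ _ := by
        rw [← measure_biUnion_finset hdisj (fun _ _ => measurableSet_ball)]
        exact ENNReal.div_le_div_right (measure_mono hsub) _

/-- The sphere has an `r`-net with at most a constant times `r ^ (-(n - 1))` points. -/
lemma exists_sphere_net {n : ℕ} (hn : 1 ≤ n) {r : ℝ} (hr : 0 < r) (hr1 : r ≤ 1) :
    ∃ N : Finset (Metric.sphere (0 : EuclideanSpace ℝ (Fin n)) 1),
      (N.card : ℝ) * (3 / 4 / 8 ^ n * (r / 2) ^ (n - 1)) ≤ 1 ∧ ∀ w, ∃ c ∈ N, dist w c < r := by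
  classical
  have hprob := isProbabilityMeasure_sphereUniform hn
  set κ : ℝ := 3 / 4 / 8 ^ n * (r / 2) ^ (n - 1) with hκ
  have hκ0 : 0 < κ := by positivity
  let Sep : Finset (Metric.sphere (0 : EuclideanSpace ℝ (Fin n)) 1) → Prop := fun N =>
    ∀ x ∈ N, ∀ y ∈ N, x ≠ y → r ≤ dist x y
  have hbound : ∀ N, Sep N → (N.card : ℝ) * κ ≤ 1 := by
    intro N hN
    have hdisj : (N : Set (Metric.sphere (0 : EuclideanSpace ℝ (Fin n)) 1)).PairwiseDisjoint
        fun c => Metric.ball c (r / 2) := by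
      intro x hx y hy hxy
      exact Metric.ball_disjoint_ball (by linarith [hN x hx y hy hxy])
    have h1 := measure_biUnion_finset (μ := sphereUniform n) hdisj (fun _ _ => measurableSet_ball)
    have h2 : ∑ c ∈ N, ENNReal.ofReal κ ≤ 1 := by
      calc _ ≤ ∑ c ∈ N, sphereUniform n (Metric.ball c (r / 2)) :=
            Finset.sum_le_sum fun c _ => le_sphereUniform_ball hn c (by positivity) (by linarith)
        _ ≤ 1 := by rw [← h1]; exact prob_le_one
    rw [Finset.sum_const, nsmul_eq_mul, ← ENNReal.ofReal_natCast,
      ← ENNReal.ofReal_mul (by positivity)] at h2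
    exact ENNReal.ofReal_le_one.1 h2
  -- An `r`-separated set of greatest cardinality is a net. The volume bound `hbound` makes the
  -- cardinalities bounded.
  let A : Set ℕ := {k | ∃ N, Sep N ∧ N.card = k}
  have hA : A.Nonempty := ⟨0, ∅, by simp [Sep], rfl⟩
  have hAb : BddAbove A := by
    refine ⟨⌊1 / κ⌋₊, ?_⟩
    rintro _ ⟨N, hN, rfl⟩
    rw [Nat.le_floor_iff (by positivity), le_div_iff₀ hκ0]
    exact hbound N hN
  obtain ⟨N, hN, hNc⟩ := Nat.sSup_mem hA hAb
  refine ⟨N, hbound N hN, fun w => ?_⟩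
  by_contra! h
  have hw : w ∉ N := fun hw => by
    have := h w hw
    rw [dist_self] at this
    linarith
  have hSep : Sep (insert w N) := by
    intro x hx y hy hxy
    rcases Finset.mem_insert.1 hx with hx | hx <;> rcases Finset.mem_insert.1 hy with hy | hy
    · exact absurd (hx.trans hy.symm) hxy
    · rw [hx]; exact h y hy
    · rw [hy, dist_comm]; exact h x hx
    · exact hN x hx y hy hxy
  have := le_csSup hAb ⟨_, hSep, rfl⟩
  rw [Finset.card_insert_of_notMem hw, hNc] at this
  omega

end

/-! ### Supports lie in small caps around the circle of the plane -/

noncomputable section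

variable {n m : ℕ} {a : Fin m → Metric.sphere (0 : EuclideanSpace ℝ (Fin n)) 1}
variable {u v : EuclideanSpace ℝ (Fin n)}

lemma comb_notMem_interior (huv : LinearIndependent ℝ ![u, v]) {S : Finset (Fin m)}
    (hS : S ∈ edgeSupports u v a) {c : Fin m → ℝ} (hc : PosWeights S c)
    (hcV : comb a c ∈ Submodule.span ℝ {u, v}) : comb a c ∉ interior (spherePolytope a) := by
  intro hint
  obtain ⟨ε, hε, hball⟩ := Metric.isOpen_iff.1 isOpen_interior _ hint
  have hpos : 0 < ‖u‖ + ‖v‖ + 1 := by positivity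
  obtain ⟨k, hk⟩ := exists_nat_one_div_lt (div_pos hε hpos)
  rw [lt_div_iff₀ hpos] at hk
  have hk0 : 0 < 1 / ((k : ℝ) + 1) := by positivity
  have key : ∀ w : EuclideanSpace ℝ (Fin n), ‖w‖ ≤ ‖u‖ + ‖v‖ →
      comb a c + (1 / ((k : ℝ) + 1)) • w ∈ spherePolytope a ∧
      comb a c - (1 / ((k : ℝ) + 1)) • w ∈ spherePolytope a := by
    intro w hw
    have h1 : ‖(1 / ((k : ℝ) + 1)) • w‖ < ε := by
      rw [norm_smul, Real.norm_of_nonneg hk0.le]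
      nlinarith
    constructor <;> refine interior_subset (hball ?_) <;> rw [Metric.mem_ball, dist_eq_norm]
    · simpa using h1
    · simpa using h1
  have h1 := key u (by linarith [norm_nonneg v])
  have h2 := key v (by linarith [norm_nonneg u])
  exact not_meetsInterior_of_mem_edgeSupports huv hS ⟨k, c, hc, hcV, h1.1, h1.2, h2.1, h2.2⟩

lemma dist_sq_sphere (x y : Metric.sphere (0 : EuclideanSpace ℝ (Fin n)) 1) :
    dist x y ^ 2 = 2 - 2 * inner ℝ (x : EuclideanSpace ℝ (Fin n)) (y : EuclideanSpace ℝ (Fin n)) := by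
  have hx : ‖(x : EuclideanSpace ℝ (Fin n))‖ = 1 := by simp
  have hy : ‖(y : EuclideanSpace ℝ (Fin n))‖ = 1 := by simp
  rw [Subtype.dist_eq, dist_eq_norm, norm_sub_sq_real, hx, hy]
  ring

/-- The points supporting an edge of the section are all nearest, among the vertices, to a common
point of the sphere: the unit outer normal of a supporting hyperplane. -/
lemma exists_normal (huv : LinearIndependent ℝ ![u, v]) {S : Finset (Fin m)}
    (hS : S ∈ edgeSupports u v a) {c : Fin m → ℝ} (hc : PosWeights S c)
    (hcV : comb a c ∈ Submodule.span ℝ {u, v}) :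
    ∃ w : Metric.sphere (0 : EuclideanSpace ℝ (Fin n)) 1,
      ∀ i ∈ S, ∀ j, dist (a i) w ≤ dist (a j) w := by
  obtain ⟨f, hf0, hf⟩ := (convex_convexHull ℝ _).exists_support_of_notMem_interior
    (comb_mem_spherePolytope hc.mem_stdSimplex) (comb_notMem_interior huv hS hc hcV)
  set y := (InnerProductSpace.toDual ℝ (EuclideanSpace ℝ (Fin n))).symm f with hy
  have hyf : ∀ z, inner ℝ y z = f z := fun z => InnerProductSpace.toDual_symm_apply
  have hy0 : 0 < ‖y‖ := by
    rw [norm_pos_iff, hy]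
    simpa using hf0
  have hmax : ∀ j, f (a j) ≤ f (comb a c) := fun j =>
    hf _ (subset_convexHull ℝ _ (mem_range_self j))
  -- A weighted mean equals the maximum only if every term of positive weight attains it.
  have heq : ∀ i ∈ S, f (a i) = f (comb a c) := by
    have h1 : ∑ i, c i * (f (comb a c) - f (a i)) = 0 := by
      simp_rw [mul_sub]
      rw [Finset.sum_sub_distrib, ← Finset.sum_mul, hc.sum, one_mul, sub_eq_zero]
      conv_lhs => rw [comb, map_sum]
      simp
    rw [Finset.sum_eq_zero_iff_of_nonneg
      (fun i _ => mul_nonneg (hc.nonneg i) (sub_nonneg.2 (hmax i)))] at h1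
    intro i hi
    have := h1 i (Finset.mem_univ i)
    rcases mul_eq_zero.1 this with h | h
    · exact absurd h (hc.pos i hi).ne'
    · linarith
  refine ⟨⟨‖y‖⁻¹ • y, by
    rw [mem_sphere_zero_iff_norm, norm_smul, norm_inv, norm_norm, inv_mul_cancel₀ hy0.ne']⟩, ?_⟩
  intro i hi j
  refine (pow_le_pow_iff_left₀ dist_nonneg dist_nonneg two_ne_zero).1 ?_
  -- On the unit sphere, a larger inner product with the normal means a smaller distance to it.
  rw [dist_sq_sphere, dist_sq_sphere]
  have : f (a j) ≤ f (a i) := (hmax j).trans (heq i hi).ge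
  have h2 : ∀ k, inner ℝ (a k : EuclideanSpace ℝ (Fin n)) (‖y‖⁻¹ • y) = ‖y‖⁻¹ * f (a k) := by
    intro k
    rw [real_inner_smul_right, real_inner_comm, hyf]
  change 2 - 2 * inner ℝ (a i : EuclideanSpace ℝ (Fin n)) (‖y‖⁻¹ • y) ≤
    2 - 2 * inner ℝ (a j : EuclideanSpace ℝ (Fin n)) (‖y‖⁻¹ • y)
  rw [h2, h2]
  have := mul_le_mul_of_nonneg_left this (inv_nonneg.2 hy0.le)
  linarith

/-- The unit circle of a plane has an `r`-net with at most a constant times `1 / r` points. -/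
lemma exists_circle_net (huv : LinearIndependent ℝ ![u, v]) {r : ℝ} (hr : 0 < r) (hr1 : r ≤ 1) :
    ∃ N : Finset (Metric.sphere (0 : EuclideanSpace ℝ (Fin n)) 1), (N.card : ℝ) ≤ 10 / r ∧
      ∀ y : EuclideanSpace ℝ (Fin n), ‖y‖ = 1 → y ∈ Submodule.span ℝ {u, v} →
        ∃ c ∈ N, dist y c ≤ r := by
  classical
  let b := (stdOrthonormalBasis ℝ (Submodule.span ℝ {u, v})).reindex
    (finCongr (finrank_span_insert_pair huv))
  let φ : ℂ ≃ₗᵢ[ℝ] Submodule.span ℝ {u, v} := Complex.orthonormalBasisOneI.repr.trans b.repr.symm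
  let g : ℝ → Metric.sphere (0 : EuclideanSpace ℝ (Fin n)) 1 := fun θ =>
    ⟨φ (Complex.exp (Complex.I * θ)), by
      rw [mem_sphere_zero_iff_norm, ← Submodule.coe_norm, φ.norm_map, mul_comm,
        Complex.norm_exp_ofReal_mul_I]⟩
  have hg : ∀ s t : ℝ, dist (φ (Complex.exp (Complex.I * s)) : EuclideanSpace ℝ (Fin n)) (g t) ≤
      |s - t| := by
    intro s t
    change dist (φ (Complex.exp (Complex.I * s)) : EuclideanSpace ℝ (Fin n))
      (φ (Complex.exp (Complex.I * t)) : EuclideanSpace ℝ (Fin n)) ≤ _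
    rw [← Subtype.dist_eq, φ.dist_map, dist_eq_norm]
    have e : Complex.exp (Complex.I * s) - Complex.exp (Complex.I * t) =
        Complex.exp (t * Complex.I) * (Complex.exp (Complex.I * (s - t : ℝ)) - 1) := by
      rw [mul_sub, ← Complex.exp_add, mul_one]
      push_cast
      congr 1
      · ring_nf
      · ring_nf
    rw [e, norm_mul, Complex.norm_exp_ofReal_mul_I, one_mul]
    exact Real.norm_exp_I_mul_ofReal_sub_one_le
  -- Angles at steps of `r`, starting from `-π`. Since `7 > 2π`, they go all the way round.
  refine ⟨(Finset.range (⌊7 / r⌋₊ + 1)).image fun k : ℕ => g (-Real.pi + k * r), ?_, ?_⟩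
  · refine (Nat.cast_le.2 Finset.card_image_le).trans ?_
    rw [Finset.card_range]
    push_cast
    have h1 := Nat.floor_le (by positivity : 0 ≤ 7 / r)
    have h2 : 1 ≤ 1 / r := by rw [le_div_iff₀ hr]; linarith
    have h3 : 10 / r = 7 / r + 3 * (1 / r) := by ring
    rw [h3]
    linarith
  · intro y hy hyV
    set z := φ.symm ⟨y, hyV⟩ with hz
    have hzn : ‖z‖ = 1 := by rw [hz, φ.symm.norm_map]; exact hy
    have hze : Complex.exp (Complex.I * z.arg) = z := by
      have := Complex.norm_mul_exp_arg_mul_I z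
      rwa [hzn, Complex.ofReal_one, one_mul, mul_comm] at this
    have hφz : (φ z : EuclideanSpace ℝ (Fin n)) = y := by rw [hz, φ.apply_symm_apply]
    have hnn : 0 ≤ (z.arg + Real.pi) / r :=
      div_nonneg (by linarith [Complex.neg_pi_lt_arg z]) hr.le
    refine ⟨_, Finset.mem_image_of_mem _ (a := ⌊(z.arg + Real.pi) / r⌋₊) ?_, ?_⟩
    · rw [Finset.mem_range, Nat.lt_succ_iff]
      refine Nat.floor_le_floor ?_
      gcongr
      linarith [Complex.arg_le_pi z, Real.pi_lt_d2]
    · have h1 := Nat.floor_le hnn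
      have h2 := (Nat.lt_floor_add_one ((z.arg + Real.pi) / r)).le
      rw [le_div_iff₀ hr] at h1
      rw [div_le_iff₀ hr] at h2
      have h3 := hg z.arg (-Real.pi + ⌊(z.arg + Real.pi) / r⌋₊ * r)
      rw [hze, hφz] at h3
      refine h3.trans ?_
      rw [abs_le]
      constructor <;> linarith

/-- If the vertices are `2r`-dense in the sphere, the points supporting an edge of the section lie
in a small cap around one of the points of a net of the circle. -/
lemma exists_ball_of_mem_edgeSupports (huv : LinearIndependent ℝ ![u, v]) {r : ℝ} (hr : 0 < r)
    (hr1 : r ≤ 1 / 4) (hcov : ∀ w : Metric.sphere (0 : EuclideanSpace ℝ (Fin n)) 1,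
      ∃ i, dist (a i) w < 2 * r)
    {N : Finset (Metric.sphere (0 : EuclideanSpace ℝ (Fin n)) 1)}
    (hN : ∀ y : EuclideanSpace ℝ (Fin n), ‖y‖ = 1 → y ∈ Submodule.span ℝ {u, v} →
        ∃ c ∈ N, dist y c ≤ r)
    {S : Finset (Fin m)} (hS : S ∈ edgeSupports u v a) :
    ∃ c ∈ N, ∀ i ∈ S, a i ∈ Metric.ball c (7 * r) := by
  obtain ⟨F, hF, p, hp, q, hq, hpq, d, hd, hpd⟩ := id hS
  have hxF := midpoint_mem_of_mem_polytopeEdges convex_sphereSection hF hp hq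
  rw [hpd] at hxF
  have hxV : comb a d ∈ Submodule.span ℝ {u, v} :=
    ((isExtreme_of_mem_polytopeEdges hF).subset hxF).2
  obtain ⟨w, hw⟩ := exists_normal huv hS hd hxV
  obtain ⟨j, hj⟩ := hcov w
  have hwS : ∀ i ∈ S, dist (a i) w < 2 * r := fun i hi => (hw i hi j).trans_lt hj
  set x := comb a d with hx
  have hw1 : ‖(w : EuclideanSpace ℝ (Fin n))‖ = 1 := by simp
  have hxw : ‖x - w‖ ≤ 2 * r := by
    have e : x - w = ∑ i, d i • ((a i : EuclideanSpace ℝ (Fin n)) - w) := by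
      simp_rw [smul_sub]
      rw [Finset.sum_sub_distrib, ← Finset.sum_smul, hd.sum, one_smul, hx, comb]
    rw [e]
    calc _ ≤ ∑ i, ‖d i • ((a i : EuclideanSpace ℝ (Fin n)) - w)‖ := norm_sum_le _ _
      _ = ∑ i, d i * ‖(a i : EuclideanSpace ℝ (Fin n)) - w‖ := by
        refine Finset.sum_congr rfl fun i _ => ?_
        rw [norm_smul, Real.norm_of_nonneg (hd.nonneg i)]
      _ ≤ ∑ i, d i * (2 * r) := by
        refine Finset.sum_le_sum fun i _ => ?_
        by_cases hi : i ∈ S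
        · refine mul_le_mul_of_nonneg_left ?_ (hd.nonneg i)
          have := (hwS i hi).le
          rwa [Subtype.dist_eq, dist_eq_norm] at this
        · rw [hd.zero i hi, zero_mul, zero_mul]
      _ = 2 * r := by rw [← Finset.sum_mul, hd.sum, one_mul]
  have hxn : |‖x‖ - 1| ≤ 2 * r := by
    have := abs_norm_sub_norm_le x w
    rw [hw1] at this
    exact this.trans hxw
  have hx0 : 0 < ‖x‖ := by
    have := (abs_le.1 hxn).1
    linarith
  obtain ⟨c, hcN, hc⟩ := hN (‖x‖⁻¹ • x)
    (by rw [norm_smul, norm_inv, norm_norm, inv_mul_cancel₀ hx0.ne'])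
    (Submodule.smul_mem _ _ hxV)
  have hxx : dist x (‖x‖⁻¹ • x) ≤ 2 * r := by
    have e : x - ‖x‖⁻¹ • x = (‖x‖ - 1) • (‖x‖⁻¹ • x) := by
      rw [sub_smul, one_smul, smul_smul, mul_inv_cancel₀ hx0.ne', one_smul]
    rw [dist_eq_norm, e, norm_smul, norm_smul, norm_inv, norm_norm, inv_mul_cancel₀ hx0.ne',
      mul_one]
    exact hxn
  refine ⟨c, hcN, fun i hi => ?_⟩
  have h1 := hwS i hi
  rw [Subtype.dist_eq] at h1
  rw [Metric.mem_ball, Subtype.dist_eq]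
  have h2 : dist (w : EuclideanSpace ℝ (Fin n)) x ≤ 2 * r := by
    rw [dist_comm, dist_eq_norm]; exact hxw
  -- The radius `7 * r` adds up as `2r` from `a i` to the normal `w`, `2r` from `w` to `x`, `2r`
  -- from `x` to its normalisation, and `r` to the net.
  have t1 := dist_triangle (a i : EuclideanSpace ℝ (Fin n)) w c
  have t2 := dist_triangle (w : EuclideanSpace ℝ (Fin n)) x c
  have t3 := dist_triangle x (‖x‖⁻¹ • x) (c : EuclideanSpace ℝ (Fin n))
  linarith

/-! ### Expectations -/

lemma spherePoints_forall_mem (hn : 1 ≤ n) (S : Finset (Fin m))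
    (B : Set (Metric.sphere (0 : EuclideanSpace ℝ (Fin n)) 1)) :
    spherePoints n m {a | ∀ i ∈ S, a i ∈ B} = sphereUniform n B ^ S.card := by
  classical
  have hprob := isProbabilityMeasure_sphereUniform hn
  have h : {a : Fin m → Metric.sphere (0 : EuclideanSpace ℝ (Fin n)) 1 | ∀ i ∈ S, a i ∈ B} =
      Set.pi univ fun i => if i ∈ S then B else univ := by
    ext a
    simp only [mem_ofPred_eq, mem_pi, mem_univ, true_imp_iff]
    refine forall_congr' fun i => ?_
    split_ifs with hi <;> simp [hi]
  rw [h, spherePoints, Measure.pi_pi]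
  simp_rw [apply_ite (sphereUniform n), measure_univ]
  rw [Finset.prod_ite]
  simp

/-- The vertices are `2r`-dense except with small probability. -/
lemma exists_bad_set (hn : 1 ≤ n) (m : ℕ) {r : ℝ} (hr : 0 < r) (hr1 : r ≤ 1) :
    ∃ B : Set (Fin m → Metric.sphere (0 : EuclideanSpace ℝ (Fin n)) 1), MeasurableSet B ∧
      spherePoints n m B ≤ ENNReal.ofReal ((3 / 4 / 8 ^ n * (r / 2) ^ (n - 1))⁻¹ *
        Real.exp (-(m * (3 / 4 / 8 ^ n * r ^ (n - 1))))) ∧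
      ∀ a ∉ B, ∀ w : Metric.sphere (0 : EuclideanSpace ℝ (Fin n)) 1,
        ∃ i, dist (a i) w < 2 * r := by
  have hprob := isProbabilityMeasure_sphereUniform hn
  obtain ⟨N, hNc, hN⟩ := exists_sphere_net hn hr hr1
  set κ : ℝ := 3 / 4 / 8 ^ n * r ^ (n - 1) with hκ
  have hκ' : 0 < 3 / 4 / 8 ^ n * (r / 2) ^ (n - 1) := by positivity
  -- The bad event is that some ball about a net point contains no vertex. A union bound over the
  -- net estimates it.
  refine ⟨⋃ c ∈ N, {a | ∀ i ∈ Finset.univ, a i ∈ (Metric.ball c r)ᶜ}, ?_, ?_, ?_⟩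
  · refine Finset.measurableSet_biUnion _ fun c _ => ?_
    simp only [Finset.mem_univ, true_imp_iff]
    have : {a : Fin m → Metric.sphere (0 : EuclideanSpace ℝ (Fin n)) 1 |
        ∀ i, a i ∈ (Metric.ball c r)ᶜ} = Set.pi univ fun _ => (Metric.ball c r)ᶜ := by
      ext a; simp
    rw [this]
    exact MeasurableSet.univ_pi fun _ => measurableSet_ball.compl
  · have hone : ∀ c ∈ N, spherePoints n m {a | ∀ i ∈ Finset.univ, a i ∈ (Metric.ball c r)ᶜ} ≤
        ENNReal.ofReal (Real.exp (-(m * κ))) := by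
      intro c _
      rw [spherePoints_forall_mem hn, Finset.card_univ, Fintype.card_fin,
        prob_compl_eq_one_sub measurableSet_ball]
      have h1 : 1 - sphereUniform n (Metric.ball c r) ≤ ENNReal.ofReal (Real.exp (-κ)) := by
        calc _ ≤ 1 - ENNReal.ofReal κ := tsub_le_tsub_left (le_sphereUniform_ball hn c hr hr1) _
          _ = ENNReal.ofReal (1 - κ) := by
            rw [ENNReal.ofReal_sub _ (by positivity), ENNReal.ofReal_one]
          _ ≤ _ := ENNReal.ofReal_le_ofReal (by linarith [Real.add_one_le_exp (-κ)])
      calc _ ≤ ENNReal.ofReal (Real.exp (-κ)) ^ m := by gcongr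
        _ = _ := by
          rw [← ENNReal.ofReal_pow (Real.exp_pos _).le, ← Real.exp_nat_mul]
          congr 2; ring
    calc _ ≤ ∑ c ∈ N, spherePoints n m {a | ∀ i ∈ Finset.univ, a i ∈ (Metric.ball c r)ᶜ} :=
          measure_biUnion_finset_le _ _
      _ ≤ ∑ c ∈ N, ENNReal.ofReal (Real.exp (-(m * κ))) := Finset.sum_le_sum hone
      _ = ENNReal.ofReal (N.card * Real.exp (-(m * κ))) := by
          rw [Finset.sum_const, nsmul_eq_mul, ENNReal.ofReal_mul (by positivity),
            ENNReal.ofReal_natCast]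
      _ ≤ _ := by
          refine ENNReal.ofReal_le_ofReal ?_
          gcongr
          rwa [← one_div, le_div_iff₀ hκ']
  · intro a ha w
    obtain ⟨c, hc, hwc⟩ := hN w
    simp only [mem_iUnion, mem_ofPred_eq, not_exists] at ha
    have := ha c hc
    push Not at this
    obtain ⟨i, -, hi⟩ := this
    rw [mem_compl_iff, not_not, Metric.mem_ball] at hi
    refine ⟨i, ?_⟩
    have := dist_triangle (a i) c w
    rw [dist_comm c w] at this
    linarith

/-- There are at most `m ^ j` sets of size `j`, so each size contributes at most `(m * x) ^ j ≤ M ^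
k`. -/
lemma sum_pow_card_le {k : ℕ} {x M : ℝ} (hx : 0 ≤ x) (hM : 1 ≤ M) (hxM : m * x ≤ M) :
    ∑ S : Finset (Fin m) with S.card ≤ k, x ^ S.card ≤ (k + 1) * M ^ k := by
  classical
  have h : ∑ S : Finset (Fin m) with S.card ≤ k, x ^ S.card =
      ∑ j ∈ Finset.range (k + 1), ∑ S ∈ (Finset.univ : Finset (Fin m)).powersetCard j, x ^ S.card := by
    rw [← Finset.sum_fiberwise_of_maps_to (g := Finset.card) (t := Finset.range (k + 1))]
    · refine Finset.sum_congr rfl fun j hj => Finset.sum_congr ?_ fun _ _ => rfl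
      ext S
      simp only [Finset.mem_filter, Finset.mem_univ, true_and, Finset.mem_powersetCard,
        Finset.subset_univ]
      constructor
      · exact fun h => h.2
      · exact fun h => ⟨by rw [h]; exact Nat.lt_succ_iff.1 (Finset.mem_range.1 hj), h⟩
    · intro S hS
      rw [Finset.mem_range, Nat.lt_succ_iff]
      exact (Finset.mem_filter.1 hS).2
  rw [h]
  have h2 : ∀ j ∈ Finset.range (k + 1),
      ∑ S ∈ (Finset.univ : Finset (Fin m)).powersetCard j, x ^ S.card ≤ M ^ k := by
    intro j hj
    calc _ = ∑ S ∈ (Finset.univ : Finset (Fin m)).powersetCard j, x ^ j :=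
          Finset.sum_congr rfl fun S hS => by rw [(Finset.mem_powersetCard.1 hS).2]
      _ = (m.choose j : ℝ) * x ^ j := by
          rw [Finset.sum_const, Finset.card_powersetCard, Finset.card_univ, Fintype.card_fin,
            nsmul_eq_mul]
      _ ≤ (m : ℝ) ^ j * x ^ j := by
          gcongr
          exact_mod_cast Nat.choose_le_pow m j
      _ = (m * x) ^ j := by rw [mul_pow]
      _ ≤ M ^ j := by gcongr
      _ ≤ M ^ k := pow_le_pow_right₀ hM (Nat.lt_succ_iff.1 (Finset.mem_range.1 hj))
  calc _ ≤ ∑ j ∈ Finset.range (k + 1), M ^ k := Finset.sum_le_sum h2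
    _ = _ := by rw [Finset.sum_const, Finset.card_range, nsmul_eq_mul]; push_cast; rfl

open Classical in
lemma sectionEdgeCount_le_sum :
    sectionEdgeCount u v a ≤ ∑ S : Finset (Fin m) with S.card ≤ n + 1,
      if S ∈ edgeSupports u v a then (1 : ENNReal) else 0 := by
  have h1 : sectionEdgeCount u v a ≤
      (({S ∈ edgeSupports u v a | S.card ≤ n + 1}.encard : ℕ∞) : ENNReal) :=
    ENat.toENNReal_le.2 encard_polytopeEdges_le
  refine h1.trans ?_
  rw [← Finset.sum_filter, Finset.sum_const, nsmul_eq_mul, mul_one, Finset.filter_filter]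
  have : {S ∈ edgeSupports u v a | S.card ≤ n + 1} =
      ((Finset.univ.filter fun S : Finset (Fin m) => S.card ≤ n + 1 ∧ S ∈ edgeSupports u v a :
        Finset (Finset (Fin m))) : Set (Finset (Fin m))) := by
    ext S
    simp [and_comm]
  rw [this, encard_coe_eq_coe_finsetCard]
  simp

lemma sectionEdgeCount_le (hm : 1 ≤ m) :
    sectionEdgeCount u v a ≤ ENNReal.ofReal ((n + 2) * (m : ℝ) ^ (n + 1)) := by
  classical
  refine sectionEdgeCount_le_sum.trans ?_
  have h := sum_pow_card_le (m := m) (k := n + 1) (x := 1) (M := m) zero_le_one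
    (by exact_mod_cast hm) (by simp)
  calc _ ≤ ∑ S : Finset (Fin m) with S.card ≤ n + 1, ENNReal.ofReal (1 ^ S.card) := by
        refine Finset.sum_le_sum fun S _ => ?_
        rw [one_pow, ENNReal.ofReal_one]
        split_ifs <;> simp
    _ ≤ _ := by
        rw [← ENNReal.ofReal_sum_of_nonneg (fun _ _ => by positivity)]
        refine ENNReal.ofReal_le_ofReal (h.trans_eq ?_)
        push_cast; ring

/-- The expected number of edges, bounded in terms of a free radius `r`. -/
lemma lintegral_sectionEdgeCount_le (hn : 1 ≤ n) (hm : 1 ≤ m) (huv : LinearIndependent ℝ ![u, v])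
    {r M : ℝ} (hr : 0 < r) (hr1 : r ≤ 1 / 4) (hM : 1 ≤ M)
    (hrM : m * (3 * 2 ^ n * (7 * r) ^ (n - 1)) ≤ M) :
    ∫⁻ a, sectionEdgeCount u v a ∂(spherePoints n m) ≤ ENNReal.ofReal
      ((n + 2) * (m : ℝ) ^ (n + 1) * ((3 / 4 / 8 ^ n * (r / 2) ^ (n - 1))⁻¹ *
        Real.exp (-(m * (3 / 4 / 8 ^ n * r ^ (n - 1))))) +
        10 / r * ((n + 2) * M ^ (n + 1))) := by
  classical
  obtain ⟨B, hBm, hBμ, hB⟩ := exists_bad_set (n := n) hn m hr (by linarith)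
  obtain ⟨N, hNc, hN⟩ := exists_circle_net huv hr (by linarith)
  set p : ℝ := 3 * 2 ^ n * (7 * r) ^ (n - 1) with hp
  have hp0 : 0 ≤ p := by positivity
  let A : Finset (Fin m) → Metric.sphere (0 : EuclideanSpace ℝ (Fin n)) 1 →
      Set (Fin m → Metric.sphere (0 : EuclideanSpace ℝ (Fin n)) 1) :=
    fun S c => {a | ∀ i ∈ S, a i ∈ Metric.ball c (7 * r)}
  have hA : ∀ S c, MeasurableSet (A S c) := by
    intro S c
    have : A S c = ⋂ i ∈ S, (fun a => a i) ⁻¹' Metric.ball c (7 * r) := by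
      ext a; simp [A]
    rw [this]
    exact Finset.measurableSet_biInter _ fun i _ => measurable_pi_apply i measurableSet_ball
  -- The trivial bound is used on the bad event. Elsewhere each support is charged to a net point
  -- whose cap contains it.
  have hpt : ∀ a, sectionEdgeCount u v a ≤
      B.indicator (fun _ => ENNReal.ofReal ((n + 2) * (m : ℝ) ^ (n + 1))) a +
      ∑ S : Finset (Fin m) with S.card ≤ n + 1, ∑ c ∈ N, (A S c).indicator 1 a := by
    intro a
    by_cases ha : a ∈ B
    · rw [indicator_of_mem ha]
      exact (sectionEdgeCount_le hm).trans le_self_add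
    · refine sectionEdgeCount_le_sum.trans (le_trans ?_ le_add_self)
      refine Finset.sum_le_sum fun S _ => ?_
      split_ifs with hS
      · obtain ⟨c, hc, hSc⟩ := exists_ball_of_mem_edgeSupports huv hr hr1 (hB a ha) hN hS
        refine le_trans ?_ (Finset.single_le_sum (fun _ _ => zero_le) hc)
        rw [indicator_of_mem (show a ∈ A S c from hSc)]
        rfl
      · exact zero_le
  have hint : ∀ S c, ∫⁻ a, (A S c).indicator 1 a ∂(spherePoints n m) ≤
      ENNReal.ofReal (p ^ S.card) := by
    intro S c
    rw [lintegral_indicator_one (hA S c)]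
    change spherePoints n m {a | ∀ i ∈ S, a i ∈ Metric.ball c (7 * r)} ≤ _
    rw [spherePoints_forall_mem hn, ENNReal.ofReal_pow hp0]
    gcongr
    exact sphereUniform_ball_le hn c (by positivity)
  have hsum : ∑ S : Finset (Fin m) with S.card ≤ n + 1, ∑ c ∈ N, ENNReal.ofReal (p ^ S.card) ≤
      ENNReal.ofReal (10 / r * ((n + 2) * M ^ (n + 1))) := by
    have h1 : ∀ S : Finset (Fin m), ∑ c ∈ N, ENNReal.ofReal (p ^ S.card) =
        ENNReal.ofReal (N.card * p ^ S.card) := fun S => by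
      rw [Finset.sum_const, nsmul_eq_mul, ENNReal.ofReal_mul (by positivity),
        ENNReal.ofReal_natCast]
    simp_rw [h1]
    rw [← ENNReal.ofReal_sum_of_nonneg (fun _ _ => by positivity), ← Finset.mul_sum]
    refine ENNReal.ofReal_le_ofReal ?_
    have h2 := sum_pow_card_le (m := m) (k := n + 1) hp0 hM hrM
    have h3 : ((n + 1 : ℕ) + 1 : ℝ) * M ^ (n + 1) = (n + 2) * M ^ (n + 1) := by
      push_cast; ring
    rw [h3] at h2
    exact mul_le_mul hNc h2 (Finset.sum_nonneg fun _ _ => by positivity) (by positivity)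
  calc _ ≤ ∫⁻ a, (B.indicator (fun _ => ENNReal.ofReal ((n + 2) * (m : ℝ) ^ (n + 1))) a +
      ∑ S : Finset (Fin m) with S.card ≤ n + 1, ∑ c ∈ N, (A S c).indicator 1 a)
        ∂(spherePoints n m) := lintegral_mono hpt
    _ = ENNReal.ofReal ((n + 2) * (m : ℝ) ^ (n + 1)) * spherePoints n m B +
        ∑ S : Finset (Fin m) with S.card ≤ n + 1, ∑ c ∈ N,
          ∫⁻ a, (A S c).indicator 1 a ∂(spherePoints n m) := by
      rw [lintegral_add_left (measurable_const.indicator hBm), lintegral_indicator_const hBm,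
        lintegral_finsetSum _ (fun S _ => Finset.measurable_sum _ fun c _ =>
          measurable_one.indicator (hA S c))]
      congr 1
      refine Finset.sum_congr rfl fun S _ => ?_
      rw [lintegral_finsetSum _ (fun c _ => measurable_one.indicator (hA S c))]
    _ ≤ ENNReal.ofReal ((n + 2) * (m : ℝ) ^ (n + 1)) * _ +
        ENNReal.ofReal (10 / r * ((n + 2) * M ^ (n + 1))) :=
      add_le_add (mul_le_mul_right hBμ _) ((Finset.sum_le_sum fun S _ => Finset.sum_le_sum fun c _ =>
        hint S c).trans hsum)
    _ = _ := by
      rw [← ENNReal.ofReal_mul (by positivity), ← ENNReal.ofReal_add (by positivity) (by positivity)]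

end

/-! ### Choice of the radius -/

theorem mainTheorem3 (n : ℕ) (hn : 2 ≤ n) :
    ∃ (C : ℝ) (k : ℕ), ∀ u v : EuclideanSpace ℝ (Fin n), LinearIndependent ℝ ![u, v] →
      ∀ m : ℕ, 2 ≤ m →
        AEMeasurable (sectionEdgeCount (m := m) u v) (spherePoints n m) ∧
        ∫⁻ a, sectionEdgeCount u v a ∂(spherePoints n m) ≤
          ENNReal.ofReal (C * (m : ℝ) ^ (1 / ((n : ℝ) - 1)) * Real.log m ^ k) := by
  set κ : ℝ := 3 / 4 / 8 ^ n with hκ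
  have hκ0 : 0 < κ := by positivity
  have hκ1 : κ ≤ 1 := by
    rw [hκ, div_le_one (by positivity)]
    have : (1 : ℝ) ≤ 8 ^ n := one_le_pow₀ (by norm_num)
    linarith
  -- Chosen so that the exponential in the bad probability becomes `m ^ (-(n + 4))`, which beats the
  -- trivial bound `m ^ (n + 1)` and the size of the net.
  set K : ℝ := (n + 4) / κ with hK
  have hK4 : 4 ≤ K := by
    rw [hK, le_div_iff₀ hκ0]
    have : (0 : ℝ) ≤ n := n.cast_nonneg
    linarith
  -- Makes `m` times the cap bound at radius `7 * r` equal to `A * log m`.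
  set A : ℝ := 3 * 2 ^ n * 7 ^ (n - 1) * K with hA
  have hA1 : 2 ≤ A := by
    have h2 : (1 : ℝ) ≤ 2 ^ n := one_le_pow₀ (by norm_num)
    have h7 : (1 : ℝ) ≤ 7 ^ (n - 1) := one_le_pow₀ (by norm_num)
    have h27 : (1 : ℝ) ≤ 2 ^ n * 7 ^ (n - 1) := one_le_mul_of_one_le_of_one_le h2 h7
    rw [hA, mul_assoc 3]
    nlinarith
  -- The three summands pay for the bad event, the main term, and the case where `r` is too large
  -- for the cap argument.
  refine ⟨(n + 2) * 2 ^ (n - 1) * 2 ^ (n + 1) + 10 * ((n + 2) * A ^ (n + 1)) +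
    (n + 2) * (4 ^ (n - 1) * K) ^ (n + 1), n + 1, ?_⟩
  intro u v huv m hm
  have hprob := isProbabilityMeasure_sphereUniform (show 1 ≤ n by omega)
  have hprob' : IsProbabilityMeasure (spherePoints n m) := by
    unfold spherePoints; infer_instance
  refine ⟨(measurable_sectionEdgeCount huv).aemeasurable, ?_⟩
  set α : ℝ := 1 / ((n : ℝ) - 1) with hα
  set L : ℝ := Real.log m with hL
  have hm0 : (0 : ℝ) < m := by positivity
  have hm2 : (2 : ℝ) ≤ m := by exact_mod_cast hm
  have hd : ((n - 1 : ℕ) : ℝ) = n - 1 := by push_cast [show 1 ≤ n by omega]; ring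
  have hd0 : (0 : ℝ) < (n : ℝ) - 1 := by
    have : (2 : ℝ) ≤ n := by exact_mod_cast hn
    linarith
  have hα0 : 0 < α := by positivity
  -- As `log 2 < 1`, the logarithm alone need not be at least `1`. The factor `2` is absorbed by the
  -- `2 ^ (n + 1)` in the constant.
  have hL1 : 1 ≤ 2 * L := by
    have := Real.log_le_log two_pos hm2
    linarith [Real.log_two_gt_d9]
  have hL0 : 0 < L := by linarith
  have hmα : 1 ≤ (m : ℝ) ^ α := Real.one_le_rpow (by linarith) hα0.le
  have hKL : 1 ≤ K * L := by nlinarith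
  set r : ℝ := (K * L / m) ^ α with hr
  have hr0 : 0 < r := by positivity
  have hrd : r ^ (n - 1) = K * L / m := by
    rw [hr, ← Real.rpow_natCast, ← Real.rpow_mul (by positivity), hd, hα,
      one_div_mul_cancel hd0.ne', Real.rpow_one]
  rw [add_mul, add_mul, add_mul, add_mul]
  rcases le_or_gt r (1 / 4) with hr4 | hr4
  · refine (lintegral_sectionEdgeCount_le (M := A * L) (by omega) (by omega) huv hr0 hr4
      (by nlinarith) (le_of_eq ?_)).trans (ENNReal.ofReal_le_ofReal ?_)
    · rw [mul_pow, hrd, hA]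
      field_simp
    have h1 : (n + 2) * (m : ℝ) ^ (n + 1) * ((κ * (r / 2) ^ (n - 1))⁻¹ *
        Real.exp (-(m * (κ * r ^ (n - 1))))) ≤
        (n + 2) * 2 ^ (n - 1) * 2 ^ (n + 1) * (m : ℝ) ^ α * L ^ (n + 1) := by
      have e1 : Real.exp (-(m * (κ * r ^ (n - 1)))) = ((m : ℝ) ^ (n + 4))⁻¹ := by
        rw [Real.exp_neg, hrd, hK]
        congr 1
        have : (m : ℝ) * (κ * ((n + 4) / κ * L / m)) = ((n + 4 : ℕ) : ℝ) * L := by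
          push_cast
          field_simp
        rw [this, Real.exp_nat_mul, hL, Real.exp_log hm0]
      have e2 : (κ * (r / 2) ^ (n - 1))⁻¹ ≤ 2 ^ (n - 1) * m := by
        have : (κ * (r / 2) ^ (n - 1))⁻¹ = 2 ^ (n - 1) * m / ((n + 4) * L) := by
          rw [div_pow, hrd, hK]
          field_simp
        rw [this]
        refine div_le_self (by positivity) ?_
        nlinarith [n.cast_nonneg (α := ℝ)]
      have e3 : (m : ℝ) ^ (n + 1) * (m * ((m : ℝ) ^ (n + 4))⁻¹) ≤ 1 := by
        rw [← mul_assoc, ← pow_succ, ← div_eq_mul_inv]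
        exact div_le_one_of_le₀ (pow_le_pow_right₀ (by linarith) (by omega)) (by positivity)
      have e4 : 1 ≤ (m : ℝ) ^ α * (2 * L) ^ (n + 1) :=
        one_le_mul_of_one_le_of_one_le hmα (one_le_pow₀ hL1)
      rw [e1]
      calc _ ≤ (n + 2) * (m : ℝ) ^ (n + 1) * ((2 ^ (n - 1) * m) * ((m : ℝ) ^ (n + 4))⁻¹) := by
            gcongr
        _ = (n + 2) * 2 ^ (n - 1) * ((m : ℝ) ^ (n + 1) * (m * ((m : ℝ) ^ (n + 4))⁻¹)) := by ring
        _ ≤ (n + 2) * 2 ^ (n - 1) * ((m : ℝ) ^ α * (2 * L) ^ (n + 1)) :=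
          mul_le_mul_of_nonneg_left (e3.trans e4) (by positivity)
        _ = _ := by rw [mul_pow]; ring
    have h2 : 10 / r * ((n + 2) * (A * L) ^ (n + 1)) ≤
        10 * ((n + 2) * A ^ (n + 1)) * (m : ℝ) ^ α * L ^ (n + 1) := by
      have e1 : 1 / r ≤ (m : ℝ) ^ α := by
        rw [hr, one_div, ← Real.inv_rpow (by positivity), inv_div]
        exact Real.rpow_le_rpow (by positivity) (div_le_self hm0.le hKL) hα0.le
      calc _ = 10 * (1 / r) * ((n + 2) * (A * L) ^ (n + 1)) := by ring
        _ ≤ 10 * (m : ℝ) ^ α * ((n + 2) * (A * L) ^ (n + 1)) := by gcongr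
        _ = _ := by rw [mul_pow]; ring
    have h3 : 0 ≤ (n + 2) * (4 ^ (n - 1) * K) ^ (n + 1) * (m : ℝ) ^ α * L ^ (n + 1) := by positivity
    linarith
  -- When `r > 1 / 4`, `m` itself is at most a constant times `log m`, so the trivial bound is
  -- already polylogarithmic.
  · have hmK : (m : ℝ) ≤ 4 ^ (n - 1) * K * L := by
      have h1 : (1 / 4 : ℝ) ^ (n - 1) ≤ r ^ (n - 1) := by gcongr
      rw [hrd, one_div, inv_pow, le_div_iff₀ hm0, inv_mul_le_iff₀ (by positivity)] at h1
      linarith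
    calc _ ≤ ∫⁻ _, ENNReal.ofReal ((n + 2) * (m : ℝ) ^ (n + 1)) ∂(spherePoints n m) :=
          lintegral_mono fun a => sectionEdgeCount_le (by omega)
      _ = ENNReal.ofReal ((n + 2) * (m : ℝ) ^ (n + 1)) := by simp
      _ ≤ _ := by
        refine ENNReal.ofReal_le_ofReal ?_
        have h1 : (n + 2) * (m : ℝ) ^ (n + 1) ≤
            (n + 2) * (4 ^ (n - 1) * K) ^ (n + 1) * (m : ℝ) ^ α * L ^ (n + 1) := by
          calc _ ≤ (n + 2) * (4 ^ (n - 1) * K * L) ^ (n + 1) := by gcongr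
            _ = (n + 2) * (4 ^ (n - 1) * K) ^ (n + 1) * 1 * L ^ (n + 1) := by rw [mul_pow]; ring
            _ ≤ _ := by gcongr
        have h2 : 0 ≤ (n + 2) * 2 ^ (n - 1) * 2 ^ (n + 1) * (m : ℝ) ^ α * L ^ (n + 1) := by
          positivity
        have h3 : 0 ≤ 10 * ((n + 2) * A ^ (n + 1)) * (m : ℝ) ^ α * L ^ (n + 1) := by positivity
        linarith
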